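/- Consider finite walks on the square lattice $\mathbb{Z}^2$ that start at $(0,0)$ and take unit steps north, east, south or west. A walk is \emph{self-avoiding} if it visits no node twice, and \emph{prudent} if it is self-avoiding and never takes a step towards an already occupied node, i.e. the lattice half-line issued from the current node in the direction of the next step contains no previously visited node. The \emph{box} of a walk is the smallest lattice rectangle that contains it. A prudent walk $\omega$ is \emph{3-sided} if each of its initial parts $\omega_i$ (the first $i$ steps, $0\le i\le |\omega|$) ends on the north, east or west side of the box of $\omega_i$, and if no step of $\omega$ leads from the south-east corner to the south-west corner of the current box, or vice versa, when that box (before the step) has width one and non-zero height. A \emph{3-sided prudent polygon} is a 3-sided prudent walk, not consisting of a single step, that ends at a node adjacent to its starting point; its \emph{area} is the area enclosed by the closed lattice polygon obtained by adding the edge from the endpoint to the starting point. Polygons are counted as walks, so different underlying walks are different polygons. Let $PA^{(3)}_n$ be the number of 3-sided prudent polygons of area $n$. Then $PA^{(3)}_n$ is finite for every $n$ (with $PA^{(3)}_0=0$), and the generating function $PA^{(3)}(q)=\sum_{n\ge 1}PA^{(3)}_n q^n$ is given, as an identity of formal power series in $q$, by $$PA^{(3)}(q) = \frac{-2q^3(1-q)^2}{(1-2q)^2}\sum_{m=1}^{\infty}\frac{(-1)^m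 q^{2m}}{(1-2q)^m(1-q-q^{m+1})} \prod_{k=1}^{m-1}\frac{1-q-q^k+q^{k+1}-q^{k+2}}{1-q-q^{k+1}}+\frac{2q(3-10q+9q^2-q^3)}{(1-2q)^2(1-q)},$$ where the sum over $m$ converges formally (each power of $q$ occurs in only finitely many summands). Its expansion begins $$PA^{(3)}(q)=6q+10q^2+20q^3+42q^4+92q^5+204q^6+454q^7+1010q^8+2242q^9+4962q^{10}+\cdots.$$ -/

import Mathlib

namespace Prudent

/-- The four unit steps on the square lattice. -/
inductive Dir where
  | north
  | east
  | south
  | west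

/-- The displacement of a step. -/
def Dir.vec : Dir → ℤ × ℤ
  | .north => (0, 1)
  | .east => (1, 0)
  | .south => (0, -1)
  | .west => (-1, 0)

/-- A finite nearest-neighbour walk on `ℤ × ℤ` started at the origin, given by its steps. -/
abbrev Walk := List Dir

namespace Walk

/-- The node reached after the first `i` steps (used for `i ≤ w.length`). -/
def pos (w : Walk) (i : ℕ) : ℤ × ℤ := ((w.take i).map Dir.vec).sum

/-- The walk visits no node twice. -/
def IsSelfAvoiding (w : Walk) : Prop :=
  ∀ i ≤ w.length, ∀ j ≤ w.length, w.pos i = w.pos j → i = j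

/-- A self-avoiding walk that never takes a step towards an already occupied node: the lattice
half-line issued from the current node in the direction of the next step contains no node
visited so far. -/
def IsPrudent (w : Walk) : Prop :=
  w.IsSelfAvoiding ∧
    ∀ (i : ℕ) (hi : i < w.length), ∀ j ≤ i, ∀ k : ℕ, 1 ≤ k → w.pos j ≠ w.pos i + k • (w[i]).vec

/-! The bounding box of the first `i` steps is `[xMin, xMax] × [yMin, yMax]`. -/

/-- Abscissa of the west side of the bounding box of the first `i` steps. -/
def xMin (w : Walk) (i : ℕ) : ℤ :=
  (Finset.range (i + 1)).inf' Finset.nonempty_range_add_one fun j => (w.pos j).1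

/-- Abscissa of the east side of the bounding box of the first `i` steps. -/
def xMax (w : Walk) (i : ℕ) : ℤ :=
  (Finset.range (i + 1)).sup' Finset.nonempty_range_add_one fun j => (w.pos j).1

/-- Ordinate of the south side of the bounding box of the first `i` steps. -/
def yMin (w : Walk) (i : ℕ) : ℤ :=
  (Finset.range (i + 1)).inf' Finset.nonempty_range_add_one fun j => (w.pos j).2

/-- Ordinate of the north side of the bounding box of the first `i` steps. -/
def yMax (w : Walk) (i : ℕ) : ℤ :=
  (Finset.range (i + 1)).sup' Finset.nonempty_range_add_one fun j => (w.pos j).2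

/-- Step number `i` (from node `i` to node `i + 1`) joins the south-east corner of the current
bounding box to its south-west corner, or vice versa, the box having width one and non-zero
height. -/
def CrossesSouthSide (w : Walk) (i : ℕ) : Prop :=
  w.xMax i - w.xMin i = 1 ∧ w.yMax i ≠ w.yMin i ∧
    ((w.pos i = (w.xMax i, w.yMin i) ∧ w.pos (i + 1) = (w.xMin i, w.yMin i)) ∨
      (w.pos i = (w.xMin i, w.yMin i) ∧ w.pos (i + 1) = (w.xMax i, w.yMin i)))

/-- A 3-sided prudent walk: every initial part ends on the north, east or west side of its
bounding box, and no step crosses the south side of a box of width one and non-zero height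
(during such a step the walk, regarded as a continuous path, would be on the south side only). -/
def IsThreeSided (w : Walk) : Prop :=
  w.IsPrudent ∧
    (∀ i ≤ w.length,
      (w.pos i).2 = w.yMax i ∨ (w.pos i).1 = w.xMax i ∨ (w.pos i).1 = w.xMin i) ∧
    ∀ i < w.length, ¬ w.CrossesSouthSide i

/-- A self-avoiding polygon: a self-avoiding walk, not of a single step, that ends at a node
adjacent to its starting point. -/
def IsPolygon (w : Walk) : Prop :=
  w.IsSelfAvoiding ∧ w.length ≠ 1 ∧ ∃ d : Dir, w.pos w.length = d.vec

/-- The area enclosed by the polygon which is obtained by closing the walk with the edge from its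
endpoint back to the origin, i.e. `|∮ x dy|` along the closed lattice polygon. An edge from `a`
to `b` contributes `a.1 * (b.2 - a.2)`, as `x` is constant on a vertical edge. -/
def area (w : Walk) : ℕ :=
  (∑ i ∈ Finset.range w.length, (w.pos i).1 * ((w.pos (i + 1)).2 - (w.pos i).2) +
    (w.pos w.length).1 * ((w.pos 0).2 - (w.pos w.length).2)).natAbs

end Walk

/-- The 3-sided prudent polygons of area `n`. -/
def threeSidedPolygons (n : ℕ) : Set Walk :=
  {w | w.IsPolygon ∧ w.IsThreeSided ∧ w.area = n}

open PowerSeries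

/-- The area generating function of 3-sided prudent polygons. -/
noncomputable def PA3 : PowerSeries ℚ :=
  PowerSeries.mk fun n => ((threeSidedPolygons n).ncard : ℚ)

/-- The summand of index `m ≥ 1`, as a formal power series in `q = X`. All series that are
inverted here have constant coefficient `1`. -/
noncomputable def summand (m : ℕ) : PowerSeries ℚ :=
  (-1) ^ m * X ^ (2 * m) * ((1 - 2 * X) ^ m * (1 - X - X ^ (m + 1)))⁻¹ *
    ∏ k ∈ Finset.Ico 1 m,
      (1 - X - X ^ k + X ^ (k + 1) - X ^ (k + 2)) * (1 - X - X ^ (k + 1))⁻¹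

end Prudent

/-! Reflection in the vertical axis preserves 3-sided prudent polygons, so it suffices to describe
and count one half of them (`threeSidedPolygons_eq`).

Three-sidedness is local: `isThreeSided_concat` tells when one more step is admissible. The ban on
crossing the south side enters through `Adm.east_extends` and `Adm.west_extends`: below the top row,
a horizontal step must leave the box. Hence a walk confined to `x ≤ 0` splits into blocks. On a
fresh western column it either moves vertically, not above the top row, and steps west (`dig`), or
it climbs to a new top row (`rise`). On a fresh top row it either moves inside the box and steps
north (`row`), or it runs west out of the box (`ext`). The blocks are prefix-free, so a walk
determines its code (`word_injOn`); every walk in `x ≤ 0` is a coded walk plus part of a block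
(`coded_of_isThreeSided`); the area is a sum over letters (`signedArea_word`).

A polygon ending at `(1, 0)` is such a walk, a step east, and a straight run along `x = 1`: this
gives `closing` and `columnPolygon` (`classify_east`). One ending at `(0, 1)` with a step east is
`hanging`, essentially a composition of the area (`classify_north`). None ends at `(0, -1)`. With
`T_w` and `E_w` the series of the codes that end in a state `top w` or `exc w`, the total is `2 (∑
T_w + q/(1-q) + q/(1-2q))`.

Removing the last letter gives `E_0 = 1`, `E_{w+1} = T_w + E_w/(1-q)` and `T_w = q^{w+1} E_w + (q +
⋯ + q^{w+1}) T_w`. For `T(u) = ∑ u^w T_w`, eliminating the `E_w` leaves a linear relation between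
`T(u)` and `T(qu)`, which is `widthSeries_eq` at `u = q^m`. Iterating it from `u = 1` produces the
sum in the theorem; the remainder is divisible by ever higher powers of `q`. -/

namespace Prudent
namespace Walk

/-! ### Visited nodes and step-by-step description of 3-sided walks -/

/-- The last node of a walk. -/
def endPt (v : Walk) : ℤ × ℤ := (v.map Dir.vec).sum

/-- The nodes visited by a walk. -/
def Vis (v : Walk) : Set (ℤ × ℤ) := {z | ∃ i ≤ v.length, v.pos i = z}

lemma pos_append_left {v : Walk} (r : Walk) {i : ℕ} (h : i ≤ v.length) :
    pos (v ++ r) i = pos v i := by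
  simp [pos, List.take_append_of_le_length h]

lemma pos_length (v : Walk) : pos v v.length = endPt v := by
  simp [pos, endPt]

@[simp] lemma endPt_nil : endPt [] = 0 := rfl

@[simp] lemma endPt_append (v r : Walk) : endPt (v ++ r) = endPt v + endPt r := by
  simp [endPt]

@[simp] lemma endPt_singleton (s : Dir) : endPt [s] = s.vec := by
  simp [endPt]

lemma endPt_concat (v : Walk) (s : Dir) : endPt (v ++ [s]) = endPt v + s.vec := by
  simp

@[simp] lemma endPt_replicate (k : ℕ) (s : Dir) : endPt (List.replicate k s) = k • s.vec := by
  simp [endPt]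

lemma mem_vis_nil {z : ℤ × ℤ} : z ∈ Vis [] ↔ z = 0 := by
  simp [Vis, pos, eq_comm]

lemma mem_vis_concat {v : Walk} {s : Dir} {z : ℤ × ℤ} :
    z ∈ Vis (v ++ [s]) ↔ z ∈ Vis v ∨ z = endPt v + s.vec := by
  constructor
  · rintro ⟨i, hi, rfl⟩
    rcases Nat.lt_or_ge v.length i with h | h
    · right
      have : i = (v ++ [s]).length := by simp at hi ⊢; omega
      rw [this, pos_length, endPt_concat]
    · left
      exact ⟨i, h, (pos_append_left _ h).symm⟩
  · rintro (⟨i, hi, rfl⟩ | rfl)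
    · exact ⟨i, by simp; omega, pos_append_left _ hi⟩
    · exact ⟨_, le_rfl, by rw [pos_length, endPt_concat]⟩

lemma endPt_mem_vis (v : Walk) : endPt v ∈ Vis v := ⟨_, le_rfl, pos_length v⟩

lemma zero_mem_vis (v : Walk) : (0, 0) ∈ Vis v := ⟨0, Nat.zero_le _, by simp [pos]; rfl⟩

lemma vis_subset_append (v r : Walk) : Vis v ⊆ Vis (v ++ r) := by
  rintro _ ⟨i, hi, rfl⟩
  exact ⟨i, by simp; omega, pos_append_left _ hi⟩

lemma mem_vis_replicate {v : Walk} {s : Dir} {k : ℕ} {z : ℤ × ℤ} :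
    z ∈ Vis (v ++ List.replicate k s) ↔
      z ∈ Vis v ∨ ∃ j : ℕ, 1 ≤ j ∧ j ≤ k ∧ z = endPt v + j • s.vec := by
  induction k with
  | zero => simp
  | succ k ih =>
    rw [List.replicate_succ', ← List.append_assoc, mem_vis_concat, ih]
    constructor
    · rintro ((h | ⟨j, h1, h2, h3⟩) | h)
      · exact Or.inl h
      · exact Or.inr ⟨j, h1, by omega, h3⟩
      · refine Or.inr ⟨k + 1, by omega, le_rfl, ?_⟩
        rw [h, endPt_append, endPt_replicate, add_smul, one_smul, add_assoc]
    · rintro (h | ⟨j, h1, h2, h3⟩)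
      · exact Or.inl (Or.inl h)
      · rcases Nat.lt_or_ge k j with h | h
        · right
          have : j = k + 1 := by omega
          rw [h3, this, endPt_append, endPt_replicate, add_smul, one_smul, add_assoc]
        · exact Or.inl (Or.inr ⟨j, h1, h, h3⟩)

/-- The half-line issued from the end of `v` in the direction `s` is free of visited nodes. -/
def Free (v : Walk) : Dir → Prop
  | .north => ∀ z ∈ Vis v, z.1 = (endPt v).1 → z.2 ≤ (endPt v).2
  | .south => ∀ z ∈ Vis v, z.1 = (endPt v).1 → (endPt v).2 ≤ z.2
  | .east => ∀ z ∈ Vis v, z.2 = (endPt v).2 → z.1 ≤ (endPt v).1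
  | .west => ∀ z ∈ Vis v, z.2 = (endPt v).2 → (endPt v).1 ≤ z.1

/-- `Free` compares coordinates, which suits linear arithmetic; the right-hand side is the form used
in `IsPrudent`. The number `k` is the difference of the relevant coordinates. -/
lemma free_iff (v : Walk) (s : Dir) :
    Free v s ↔ ∀ z ∈ Vis v, ∀ k : ℕ, 1 ≤ k → z ≠ endPt v + k • s.vec := by
  constructor
  · intro h z hz k hk e
    have e1 := congrArg Prod.fst e
    have e2 := congrArg Prod.snd e
    cases s <;> simp only [Free] at h <;> have := h z hz <;>
      simp [Dir.vec] at e1 e2 <;> omega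
  · intro h
    cases s <;> intro z hz e <;> by_contra hlt
    · refine h z hz (z.2 - (endPt v).2).toNat (by omega) (Prod.ext ?_ ?_) <;>
        simp [Dir.vec] <;> omega
    · refine h z hz (z.1 - (endPt v).1).toNat (by omega) (Prod.ext ?_ ?_) <;>
        simp [Dir.vec] <;> omega
    · refine h z hz ((endPt v).2 - z.2).toNat (by omega) (Prod.ext ?_ ?_) <;>
        simp [Dir.vec] <;> omega
    · refine h z hz ((endPt v).1 - z.1).toNat (by omega) (Prod.ext ?_ ?_) <;>
        simp [Dir.vec] <;> omega

/-- The node `e` lies on the north, east or west side of the bounding box of `S ∪ {e}`. -/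
def OnSide (S : Set (ℤ × ℤ)) (e : ℤ × ℤ) : Prop :=
  (∀ z ∈ S, z.2 ≤ e.2) ∨ (∀ z ∈ S, z.1 ≤ e.1) ∨ ∀ z ∈ S, e.1 ≤ z.1

/-- The step from `e` to `e'` joins the two ends of the south side of the bounding box of `S`,
which has width one and positive height. -/
def Crossing (S : Set (ℤ × ℤ)) (e e' : ℤ × ℤ) : Prop :=
  e'.1 ≠ e.1 ∧ (∃ z ∈ S, z.1 = e'.1) ∧ (∀ z ∈ S, z.1 = e.1 ∨ z.1 = e'.1) ∧
    (∀ z ∈ S, e.2 ≤ z.2) ∧ ∃ z ∈ S, e.2 < z.2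

/-! ### The sides of the bounding box as attained bounds -/

section box

variable (v : Walk) (i : ℕ)

lemma le_xMax {j : ℕ} (h : j ≤ i) : (v.pos j).1 ≤ v.xMax i :=
  Finset.le_sup' (fun j => (v.pos j).1) (Finset.mem_range_succ_iff.2 h)

lemma xMin_le {j : ℕ} (h : j ≤ i) : v.xMin i ≤ (v.pos j).1 :=
  Finset.inf'_le (fun j => (v.pos j).1) (Finset.mem_range_succ_iff.2 h)

lemma le_yMax {j : ℕ} (h : j ≤ i) : (v.pos j).2 ≤ v.yMax i :=
  Finset.le_sup' (fun j => (v.pos j).2) (Finset.mem_range_succ_iff.2 h)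

lemma yMin_le {j : ℕ} (h : j ≤ i) : v.yMin i ≤ (v.pos j).2 :=
  Finset.inf'_le (fun j => (v.pos j).2) (Finset.mem_range_succ_iff.2 h)

lemma exists_xMax : ∃ j ≤ i, (v.pos j).1 = v.xMax i := by
  obtain ⟨j, hj, h⟩ := Finset.exists_mem_eq_sup' (Finset.nonempty_range_add_one (n := i))
    (fun j => (v.pos j).1)
  exact ⟨j, Finset.mem_range_succ_iff.1 hj, h.symm⟩

lemma exists_xMin : ∃ j ≤ i, (v.pos j).1 = v.xMin i := by
  obtain ⟨j, hj, h⟩ := Finset.exists_mem_eq_inf' (Finset.nonempty_range_add_one (n := i))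
    (fun j => (v.pos j).1)
  exact ⟨j, Finset.mem_range_succ_iff.1 hj, h.symm⟩

lemma exists_yMax : ∃ j ≤ i, (v.pos j).2 = v.yMax i := by
  obtain ⟨j, hj, h⟩ := Finset.exists_mem_eq_sup' (Finset.nonempty_range_add_one (n := i))
    (fun j => (v.pos j).2)
  exact ⟨j, Finset.mem_range_succ_iff.1 hj, h.symm⟩

lemma exists_yMin : ∃ j ≤ i, (v.pos j).2 = v.yMin i := by
  obtain ⟨j, hj, h⟩ := Finset.exists_mem_eq_inf' (Finset.nonempty_range_add_one (n := i))
    (fun j => (v.pos j).2)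
  exact ⟨j, Finset.mem_range_succ_iff.1 hj, h.symm⟩

end box

/-- The nodes visited during the first `i` steps. -/
lemma mem_vis_take {v : Walk} {i : ℕ} (hi : i ≤ v.length) {z : ℤ × ℤ} :
    z ∈ Vis (v.take i) ↔ ∃ j ≤ i, v.pos j = z := by
  have hl : (v.take i).length = i := by simp [hi]
  have hp : ∀ j ≤ i, pos (v.take i) j = v.pos j := fun j hj => by
    simp [pos, List.take_take, hj]
  constructor
  · rintro ⟨j, hj, rfl⟩
    exact ⟨j, hl ▸ hj, (hp j (hl ▸ hj)).symm⟩
  · rintro ⟨j, hj, rfl⟩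
    exact ⟨j, hl.symm ▸ hj, hp j hj⟩

lemma onSide_pos_iff {v : Walk} {i : ℕ} (hi : i ≤ v.length) :
    ((v.pos i).2 = v.yMax i ∨ (v.pos i).1 = v.xMax i ∨ (v.pos i).1 = v.xMin i) ↔
      OnSide (Vis (v.take i)) (endPt (v.take i)) := by
  have he : endPt (v.take i) = v.pos i := rfl
  rw [he]
  refine or_congr ?_ (or_congr ?_ ?_)
  · constructor
    · intro h z hz
      obtain ⟨j, hj, rfl⟩ := (mem_vis_take hi).1 hz
      exact (le_yMax v i hj).trans h.ge
    · intro h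
      obtain ⟨j, hj, hm⟩ := exists_yMax v i
      exact le_antisymm (le_yMax v i le_rfl) (hm ▸ h _ ((mem_vis_take hi).2 ⟨j, hj, rfl⟩))
  · constructor
    · intro h z hz
      obtain ⟨j, hj, rfl⟩ := (mem_vis_take hi).1 hz
      exact (le_xMax v i hj).trans h.ge
    · intro h
      obtain ⟨j, hj, hm⟩ := exists_xMax v i
      exact le_antisymm (le_xMax v i le_rfl) (hm ▸ h _ ((mem_vis_take hi).2 ⟨j, hj, rfl⟩))
  · constructor
    · intro h z hz
      obtain ⟨j, hj, rfl⟩ := (mem_vis_take hi).1 hz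
      exact h.le.trans (xMin_le v i hj)
    · intro h
      obtain ⟨j, hj, hm⟩ := exists_xMin v i
      exact le_antisymm (hm ▸ h _ ((mem_vis_take hi).2 ⟨j, hj, rfl⟩)) (xMin_le v i le_rfl)

lemma pos_succ {v : Walk} {i : ℕ} (hi : i < v.length) : v.pos (i + 1) = v.pos i + (v[i]).vec := by
  unfold pos
  rw [List.take_succ_eq_append_getElem hi, List.map_append, List.sum_append]
  simp

/-- A box has width one exactly when the visited nodes fill two adjacent columns; the current node
is a southern corner if nothing lies below it. -/
lemma crossesSouthSide_iff {v : Walk} {i : ℕ} (hi : i < v.length) :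
    v.CrossesSouthSide i ↔
      Crossing (Vis (v.take i)) (v.pos i) (v.pos (i + 1)) := by
  have mem : ∀ j ≤ i, v.pos j ∈ Vis (v.take i) := fun j hj => (mem_vis_take hi.le).2 ⟨j, hj, rfl⟩
  obtain ⟨a, ha, ha'⟩ := exists_xMax v i
  obtain ⟨b, hb, hb'⟩ := exists_xMin v i
  obtain ⟨c, hc, hc'⟩ := exists_yMax v i
  obtain ⟨d, hd, hd'⟩ := exists_yMin v i
  have hX := fun j hj => le_xMax v i (j := j) hj
  have hx := fun j hj => xMin_le v i (j := j) hj
  have hY := fun j hj => le_yMax v i (j := j) hj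
  have hy := fun j hj => yMin_le v i (j := j) hj
  constructor
  · rintro ⟨h1, h2, h3⟩
    have key : (v.pos i).2 = v.yMin i ∧ v.pos (i+1) ≠ v.pos i ∧
        (((v.pos i).1 = v.xMax i ∧ (v.pos (i+1)).1 = v.xMin i) ∨
          ((v.pos i).1 = v.xMin i ∧ (v.pos (i+1)).1 = v.xMax i)) := by
      rcases h3 with ⟨e, e'⟩ | ⟨e, e'⟩ <;> rw [e, e'] <;> simp <;> omega
    obtain ⟨k1, -, k3⟩ := key
    refine ⟨by omega, ?_, ?_, ?_, ?_⟩
    · rcases k3 with ⟨e, e'⟩ | ⟨e, e'⟩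
      · exact ⟨_, mem b hb, by omega⟩
      · exact ⟨_, mem a ha, by omega⟩
    · intro z hz
      obtain ⟨j, hj, rfl⟩ := (mem_vis_take hi.le).1 hz
      have := hX _ hj
      have := hx _ hj
      omega
    · intro z hz
      obtain ⟨j, hj, rfl⟩ := (mem_vis_take hi.le).1 hz
      have := hy _ hj
      omega
    · refine ⟨_, mem c hc, ?_⟩
      have := hy _ hc
      omega
  · rintro ⟨h1, ⟨z, hz, hz'⟩, h3, h4, y, hy1, hy2⟩
    obtain ⟨j, hj, rfl⟩ := (mem_vis_take hi.le).1 hz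
    obtain ⟨l, hl, rfl⟩ := (mem_vis_take hi.le).1 hy1
    have s1 := pos_succ hi
    -- A unit step that changes the abscissa is horizontal, so the two columns are adjacent.
    have s2 : (v.pos (i+1)).2 = (v.pos i).2 ∧
        ((v.pos (i+1)).1 = (v.pos i).1 + 1 ∨ (v.pos (i+1)).1 = (v.pos i).1 - 1) := by
      rw [s1] at h1 ⊢
      generalize v[i] = s at h1 ⊢
      cases s <;> simp [Dir.vec] at h1 ⊢
      omega
    have := h3 _ (mem a ha)
    have := h3 _ (mem b hb)
    have := h4 _ (mem d hd)
    have := hy i le_rfl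
    have := hX i le_rfl
    have := hx i le_rfl
    have := hX _ hj
    have := hx _ hj
    have := hY _ hl
    refine ⟨by omega, by omega, ?_⟩
    rcases s2.2 with h | h
    · right
      constructor <;> ext <;> simp <;> omega
    · left
      constructor <;> ext <;> simp <;> omega

lemma isThreeSided_nil : IsThreeSided [] := by
  refine ⟨⟨?_, ?_⟩, ?_, ?_⟩
  · intro i hi j hj _
    simp at hi hj
    omega
  · intro i hi
    simp at hi
  · intro i hi
    simp at hi
    subst hi
    exact (onSide_pos_iff le_rfl).2 (Or.inl fun z hz => by simp [mem_vis_nil] at hz; simp [hz])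
  · intro i hi
    simp at hi

/-- `v` may be continued by the step `s` to a 3-sided walk. -/
structure Adm (v : Walk) (s : Dir) : Prop where
  free : Free v s
  side : OnSide (Vis v) (endPt v + s.vec)
  cross : ¬ Crossing (Vis v) (endPt v) (endPt v + s.vec)

/-- The node `e` satisfies its own inequalities trivially. This lets `Adm.side` refer only to nodes
visited before the step. -/
lemma onSide_insert {S T : Set (ℤ × ℤ)} {e : ℤ × ℤ} (h : ∀ z, z ∈ T ↔ z ∈ S ∨ z = e) :
    OnSide T e ↔ OnSide S e := by
  simp only [OnSide, h, or_imp, forall_and, forall_eq, le_refl, and_true]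

/-- Every defining condition concerns an initial part of the walk, so only the conditions at the
last step are new. All later inductions on walks use this. -/
theorem isThreeSided_concat {v : Walk} {s : Dir} :
    IsThreeSided (v ++ [s]) ↔ IsThreeSided v ∧ Adm v s := by
  have hlen : (v ++ [s]).length = v.length + 1 := by simp
  have hp : ∀ i ≤ v.length, pos (v ++ [s]) i = pos v i := fun i hi => pos_append_left _ hi
  have hpl : pos (v ++ [s]) (v.length + 1) = endPt v + s.vec := by
    rw [← hlen, pos_length, endPt_concat]
  have htake : ∀ i ≤ v.length, (v ++ [s]).take i = v.take i := fun i hi =>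
    List.take_append_of_le_length hi
  have hcr : ∀ i < v.length, ((v ++ [s]).CrossesSouthSide i ↔ v.CrossesSouthSide i) := by
    intro i hi
    rw [crossesSouthSide_iff hi, crossesSouthSide_iff (by omega), hp i hi.le, hp (i+1) hi,
      htake i hi.le]
  have hcr' : (v ++ [s]).CrossesSouthSide v.length ↔
      Crossing (Vis v) (endPt v) (endPt v + s.vec) := by
    rw [crossesSouthSide_iff (by omega), hp _ le_rfl, hpl, htake _ le_rfl, List.take_length,
      pos_length]
  have hsd : ∀ i ≤ v.length, (((v ++ [s]).pos i).2 = (v ++ [s]).yMax i ∨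
      ((v ++ [s]).pos i).1 = (v ++ [s]).xMax i ∨ ((v ++ [s]).pos i).1 = (v ++ [s]).xMin i ↔
      ((v.pos i).2 = v.yMax i ∨ (v.pos i).1 = v.xMax i ∨ (v.pos i).1 = v.xMin i)) := by
    intro i hi
    rw [onSide_pos_iff (by omega), onSide_pos_iff hi, htake i hi]
  have hsd' : (((v ++ [s]).pos (v.length + 1)).2 = (v ++ [s]).yMax (v.length + 1) ∨
      ((v ++ [s]).pos (v.length + 1)).1 = (v ++ [s]).xMax (v.length + 1) ∨
      ((v ++ [s]).pos (v.length + 1)).1 = (v ++ [s]).xMin (v.length + 1) ↔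
      OnSide (Vis v) (endPt v + s.vec)) := by
    rw [onSide_pos_iff (by omega), ← hlen, List.take_length, endPt_concat]
    exact onSide_insert fun z => mem_vis_concat
  constructor
  · rintro ⟨⟨h1, h2⟩, h3, h4⟩
    refine ⟨⟨⟨?_, ?_⟩, ?_, ?_⟩, ?_, ?_, ?_⟩
    · intro i hi j hj e
      exact h1 i (by omega) j (by omega) (by rwa [hp i hi, hp j hj])
    · intro i hi j hj k hk
      have := h2 i (by omega) j hj k hk
      rwa [hp i hi.le, hp j (by omega), List.getElem_append_left hi] at this
    · intro i hi
      exact (hsd i hi).1 (h3 i (by omega))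
    · intro i hi
      exact fun h => h4 i (by omega) ((hcr i hi).2 h)
    · rw [free_iff]
      rintro _ ⟨j, hj, rfl⟩ k hk
      have := h2 v.length (by omega) j hj k hk
      rwa [hp j hj, hp _ le_rfl, pos_length, List.getElem_concat_length rfl] at this
    · exact hsd'.1 (h3 _ (by omega))
    · exact fun h => h4 v.length (by omega) (hcr'.2 h)
  · rintro ⟨⟨⟨h1, h2⟩, h3, h4⟩, f, sd, cr⟩
    rw [free_iff] at f
    -- The case `k = 1` of freeness is self-avoidance at the new node.
    have f1 : ∀ i ≤ v.length, pos v i ≠ endPt v + s.vec := fun i hi => by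
      simpa using f _ ⟨i, hi, rfl⟩ 1 le_rfl
    refine ⟨⟨?_, ?_⟩, ?_, ?_⟩
    · intro i hi j hj e
      rcases Nat.lt_or_ge v.length i with a | a <;> rcases Nat.lt_or_ge v.length j with b | b
      · omega
      · obtain rfl : i = v.length + 1 := by omega
        rw [hpl, hp j b] at e
        exact absurd e.symm (f1 j b)
      · obtain rfl : j = v.length + 1 := by omega
        rw [hpl, hp i a] at e
        exact absurd e (f1 i a)
      · rw [hp i a, hp j b] at e
        exact h1 i a j b e
    · intro i hi j hj k hk
      rcases Nat.lt_or_ge i v.length with a | a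
      · rw [hp i a.le, hp j (by omega), List.getElem_append_left a]
        exact h2 i a j hj k hk
      · obtain rfl : i = v.length := by omega
        rw [hp _ hj, hp _ le_rfl, pos_length, List.getElem_concat_length rfl]
        exact f _ ⟨j, hj, rfl⟩ k hk
    · intro i hi
      rcases Nat.lt_or_ge v.length i with a | a
      · obtain rfl : i = v.length + 1 := by omega
        exact hsd'.2 sd
      · exact (hsd i a).2 (h3 i a)
    · intro i hi
      rcases Nat.lt_or_ge i v.length with a | a
      · exact fun h => h4 i a ((hcr i a).1 h)
      · obtain rfl : i = v.length := by omega
        exact fun h => cr (hcr'.1 h)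

lemma IsThreeSided.of_append {v r : Walk} (h : IsThreeSided (v ++ r)) : IsThreeSided v := by
  induction r using List.reverseRecOn with
  | nil => simpa using h
  | append_singleton r s ih =>
    rw [← List.append_assoc, isThreeSided_concat] at h
    exact ih h.1

lemma IsThreeSided.onSide {v : Walk} (h : IsThreeSided v) : OnSide (Vis v) (endPt v) := by
  have := (onSide_pos_iff le_rfl).1 (h.2.1 v.length le_rfl)
  rwa [List.take_length] at this

lemma IsThreeSided.adm {v r : Walk} {s : Dir} (h : IsThreeSided (v ++ s :: r)) : Adm v s := by
  have : IsThreeSided ((v ++ [s]) ++ r) := by simpa using h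
  exact (isThreeSided_concat.1 this.of_append).2

lemma Adm.endPt_notMem {v : Walk} {s : Dir} (h : Adm v s) : endPt v + s.vec ∉ Vis v := by
  intro hm
  have := (free_iff v s).1 h.free _ hm 1 le_rfl
  simp at this

end Walk
end Prudent

namespace Prudent
namespace Walk

/-! ### Consequences of the local rules -/

/-- A discrete intermediate value theorem: one step changes the ordinate by at most one. -/
lemma exists_vis_row {u : Walk} {a b : ℤ × ℤ} (ha : a ∈ Vis u) (hb : b ∈ Vis u) {y : ℤ}
    (h1 : a.2 ≤ y) (h2 : y ≤ b.2) : ∃ z ∈ Vis u, z.2 = y := by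
  induction u using List.reverseRecOn generalizing a b with
  | nil =>
    rw [mem_vis_nil] at ha hb
    subst ha hb
    exact ⟨0, mem_vis_nil.2 rfl, by omega⟩
  | append_singleton u s ih =>
    have he := endPt_mem_vis u
    have hstep : (endPt u + s.vec).2 ≤ (endPt u).2 + 1 ∧
        (endPt u).2 - 1 ≤ (endPt u + s.vec).2 := by
      cases s <;> simp [Dir.vec]
      omega
    by_cases hy : (endPt u + s.vec).2 = y
    · exact ⟨_, mem_vis_concat.2 (Or.inr rfl), hy⟩
    have up : ∀ {z w}, z ∈ Vis u → w ∈ Vis u → z.2 ≤ y → y ≤ w.2 →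
        ∃ z ∈ Vis (u ++ [s]), z.2 = y := fun hz hw h h' => by
      obtain ⟨x, hx, hxy⟩ := ih hz hw h h'
      exact ⟨x, mem_vis_concat.2 (Or.inl hx), hxy⟩
    rcases mem_vis_concat.1 ha with ha | rfl <;> rcases mem_vis_concat.1 hb with hb | rfl
    · exact up ha hb h1 h2
    · exact up ha he h1 (by omega)
    · exact up he hb (by omega) h2
    · omega

lemma exists_vis_column {u : Walk} {a b : ℤ × ℤ} (ha : a ∈ Vis u) (hb : b ∈ Vis u) {x : ℤ}
    (h1 : a.1 ≤ x) (h2 : x ≤ b.1) : ∃ z ∈ Vis u, z.1 = x := by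
  induction u using List.reverseRecOn generalizing a b with
  | nil =>
    rw [mem_vis_nil] at ha hb
    subst ha hb
    exact ⟨0, mem_vis_nil.2 rfl, by omega⟩
  | append_singleton u s ih =>
    have he := endPt_mem_vis u
    have hstep : (endPt u + s.vec).1 ≤ (endPt u).1 + 1 ∧
        (endPt u).1 - 1 ≤ (endPt u + s.vec).1 := by
      cases s <;> simp [Dir.vec]
      omega
    by_cases hx : (endPt u + s.vec).1 = x
    · exact ⟨_, mem_vis_concat.2 (Or.inr rfl), hx⟩
    have up : ∀ {z w}, z ∈ Vis u → w ∈ Vis u → z.1 ≤ x → x ≤ w.1 →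
        ∃ z ∈ Vis (u ++ [s]), z.1 = x := fun hz hw h h' => by
      obtain ⟨y, hy, hxy⟩ := ih hz hw h h'
      exact ⟨y, mem_vis_concat.2 (Or.inl hy), hxy⟩
    rcases mem_vis_concat.1 ha with ha | rfl <;> rcases mem_vis_concat.1 hb with hb | rfl
    · exact up ha hb h1 h2
    · exact up ha he h1 (by omega)
    · exact up he hb (by omega) h2
    · omega

/-- A horizontal step between the two columns of a box of width one is impossible below the top
row. -/
lemma Adm.false_of_two_columns {v : Walk} {s : Dir} (h3 : IsThreeSided v) (h : Adm v s)
    (hs : s.vec.2 = 0) (hs' : s.vec.1 ≠ 0) {z z' : ℤ × ℤ} (hz : z ∈ Vis v)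
    (hlt : (endPt v).2 < z.2) (hz' : z' ∈ Vis v) (hz1 : z'.1 = (endPt v + s.vec).1)
    (hcol : ∀ x ∈ Vis v, x.1 = (endPt v).1 ∨ x.1 = (endPt v + s.vec).1) : False := by
  have hnc := h.cross
  have he2 : (endPt v + s.vec).2 = (endPt v).2 := by simp [hs]
  -- Otherwise the current row is the south side, and the step is a forbidden crossing.
  have : ∃ x ∈ Vis v, x.2 < (endPt v).2 := by
    by_contra hcon
    push Not at hcon
    exact hnc ⟨by simpa using hs', ⟨z', hz', hz1⟩, hcol, hcon, ⟨z, hz, hlt⟩⟩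
  obtain ⟨x, hx, hx2⟩ := this
  rcases List.eq_nil_or_concat' v with rfl | ⟨u, t, rfl⟩
  · rw [mem_vis_nil] at hx hz
    subst hx hz
    omega
  have hxu : x ∈ Vis u := by
    rcases mem_vis_concat.1 hx with hx | rfl
    · exact hx
    · rw [endPt_concat] at hx2; omega
  have hzu : z ∈ Vis u := by
    rcases mem_vis_concat.1 hz with hz | rfl
    · exact hz
    · rw [endPt_concat] at hlt; omega
  -- Nodes above and below were both visited before the last step, so the current row had already
  -- been met, in one of the two columns. That earlier node is either the present end or the target
  -- of the step, and both are excluded.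
  obtain ⟨r, hr, hr2⟩ := exists_vis_row hxu hzu hx2.le hlt.le
  have hrv : r ∈ Vis (u ++ [t]) := mem_vis_concat.2 (Or.inl hr)
  rcases hcol r hrv with e | e
  · have : r = endPt u + t.vec := by
      rw [endPt_concat] at e hr2
      exact Prod.ext e hr2
    exact (isThreeSided_concat.1 h3).2.endPt_notMem (this ▸ hr)
  · exact h.endPt_notMem ((Prod.ext e (hr2.trans he2.symm) : r = _) ▸ hrv)

/-- Below the top row, a step to the east leaves the bounding box. -/
lemma Adm.east_extends {v : Walk} (h3 : IsThreeSided v) (h : Adm v .east) {z : ℤ × ℤ}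
    (hz : z ∈ Vis v) (hlt : (endPt v).2 < z.2) : ∀ x ∈ Vis v, x.1 ≤ (endPt v).1 := by
  intro x hx
  by_contra hxe
  have he := endPt_mem_vis v
  -- The end is on neither the north nor the east side, hence on the west side; after the step it
  -- must be on the east side. So the box has only two columns.
  have s1 : ∀ y ∈ Vis v, (endPt v).1 ≤ y.1 := by
    rcases h3.onSide with k | k | k
    · have := k z hz; omega
    · have := k x hx; omega
    · exact k
  have s2 : ∀ y ∈ Vis v, y.1 ≤ (endPt v).1 + 1 := by
    rcases h.side with k | k | k
    · have := k z hz; simp [Dir.vec] at this; omega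
    · simpa [Dir.vec] using k
    · have := k _ he; simp [Dir.vec] at this
  refine h.false_of_two_columns h3 rfl (by simp [Dir.vec]) hz hlt hx ?_ ?_
  · have := s2 x hx; simp [Dir.vec]; omega
  · intro y hy
    have := s1 y hy
    have := s2 y hy
    simp [Dir.vec]; omega

/-- Below the top row, a step to the west leaves the bounding box. -/
lemma Adm.west_extends {v : Walk} (h3 : IsThreeSided v) (h : Adm v .west) {z : ℤ × ℤ}
    (hz : z ∈ Vis v) (hlt : (endPt v).2 < z.2) : ∀ x ∈ Vis v, (endPt v).1 ≤ x.1 := by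
  intro x hx
  by_contra hxe
  have he := endPt_mem_vis v
  have s1 : ∀ y ∈ Vis v, y.1 ≤ (endPt v).1 := by
    rcases h3.onSide with k | k | k
    · have := k z hz; omega
    · exact k
    · have := k x hx; omega
  have s2 : ∀ y ∈ Vis v, (endPt v).1 - 1 ≤ y.1 := by
    rcases h.side with k | k | k
    · have := k z hz; simp [Dir.vec] at this; omega
    · have := k _ he; simp [Dir.vec] at this
    · intro y hy
      have := k y hy
      simp [Dir.vec] at this
      omega
  refine h.false_of_two_columns h3 rfl (by simp [Dir.vec]) hz hlt hx ?_ ?_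
  · have := s2 x hx; simp [Dir.vec]; omega
  · intro y hy
    have := s1 y hy
    have := s2 y hy
    simp [Dir.vec]; omega

/-- A walk on the west or east side may run vertically towards free nodes. -/
lemma IsThreeSided.run_vertical {v : Walk} (h3 : IsThreeSided v) {s : Dir} (hs : s.vec.1 = 0)
    (hf : Free v s) (hside : (∀ z ∈ Vis v, (endPt v).1 ≤ z.1) ∨ ∀ z ∈ Vis v, z.1 ≤ (endPt v).1)
    (k : ℕ) : IsThreeSided (v ++ List.replicate k s) := by
  induction k with
  | zero => simpa using h3
  | succ k ih =>
    rw [List.replicate_succ', ← List.append_assoc, isThreeSided_concat]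
    rw [free_iff] at hf
    refine ⟨ih, ?_, ?_, ?_⟩
    · rw [free_iff]
      intro z hz j hj
      rw [endPt_append, endPt_replicate]
      rcases mem_vis_replicate.1 hz with hz | ⟨i, hi, hik, rfl⟩
      · rw [add_assoc, ← add_smul]
        exact hf z hz _ (by omega)
      · intro e
        have e1 := congrArg Prod.fst e
        have e2 := congrArg Prod.snd e
        cases s <;> simp [Dir.vec] at e1 e2 hs <;> omega
    · rcases hside with hl | hl
      · right; right
        intro z hz
        rcases mem_vis_replicate.1 hz with hz | ⟨i, hi, hik, rfl⟩
        · simpa [hs] using hl z hz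
        · simp [hs]
      · right; left
        intro z hz
        rcases mem_vis_replicate.1 hz with hz | ⟨i, hi, hik, rfl⟩
        · simpa [hs] using hl z hz
        · simp [hs]
    · intro hc
      exact hc.1 (by simp [hs])

/-- A walk on the top row may run horizontally towards free nodes. -/
lemma IsThreeSided.run_horizontal {v : Walk} (h3 : IsThreeSided v) {s : Dir} (hs : s.vec.2 = 0)
    (hf : Free v s) (hside : ∀ z ∈ Vis v, z.2 ≤ (endPt v).2)
    (k : ℕ) : IsThreeSided (v ++ List.replicate k s) := by
  induction k with
  | zero => simpa using h3
  | succ k ih =>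
    rw [List.replicate_succ', ← List.append_assoc, isThreeSided_concat]
    rw [free_iff] at hf
    have hN : ∀ z ∈ Vis (v ++ List.replicate k s),
        z.2 ≤ (endPt (v ++ List.replicate k s)).2 := by
      intro z hz
      rcases mem_vis_replicate.1 hz with hz | ⟨i, hi, hik, rfl⟩
      · simpa [hs] using hside z hz
      · simp [hs]
    refine ⟨ih, ?_, Or.inl ?_, ?_⟩
    · rw [free_iff]
      intro z hz j hj
      rw [endPt_append, endPt_replicate]
      rcases mem_vis_replicate.1 hz with hz | ⟨i, hi, hik, rfl⟩
      · rw [add_assoc, ← add_smul]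
        exact hf z hz _ (by omega)
      · intro e
        have e1 := congrArg Prod.fst e
        have e2 := congrArg Prod.snd e
        cases s <;> simp [Dir.vec] at e1 e2 hs <;> omega
    · intro z hz
      simpa [hs] using hN z hz
    · rintro ⟨-, -, -, -, z, hz, hlt⟩
      exact absurd (hN z hz) (by omega)

/-- A walk on the west side may step to the west. -/
lemma IsThreeSided.step_west {v : Walk} (h3 : IsThreeSided v)
    (hside : ∀ z ∈ Vis v, (endPt v).1 ≤ z.1) : IsThreeSided (v ++ [.west]) := by
  refine isThreeSided_concat.2 ⟨h3, fun z hz _ => hside z hz, Or.inr (Or.inr ?_), ?_⟩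
  · intro z hz
    have := hside z hz
    simp [Dir.vec]; omega
  · rintro ⟨-, ⟨z, hz, hz1⟩, -⟩
    have := hside z hz
    simp [Dir.vec] at hz1; omega

/-- A walk on the east side may step to the east. -/
lemma IsThreeSided.step_east {v : Walk} (h3 : IsThreeSided v)
    (hside : ∀ z ∈ Vis v, z.1 ≤ (endPt v).1) : IsThreeSided (v ++ [.east]) := by
  refine isThreeSided_concat.2 ⟨h3, fun z hz _ => hside z hz, Or.inr (Or.inl ?_), ?_⟩
  · intro z hz
    have := hside z hz
    simp [Dir.vec]; omega
  · rintro ⟨-, ⟨z, hz, hz1⟩, -⟩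
    have := hside z hz
    simp [Dir.vec] at hz1; omega

/-- A walk on the north side may step to the north. -/
lemma IsThreeSided.step_north {v : Walk} (h3 : IsThreeSided v)
    (hside : ∀ z ∈ Vis v, z.2 ≤ (endPt v).2) : IsThreeSided (v ++ [.north]) := by
  refine isThreeSided_concat.2 ⟨h3, fun z hz _ => hside z hz, Or.inl ?_, ?_⟩
  · intro z hz
    have := hside z hz
    simp [Dir.vec]; omega
  · rintro ⟨h, -⟩
    simp [Dir.vec] at h

/-! ### Prefixes -/

lemma endPt_of_prefix {p w : Walk} (h : p <+: w) : endPt p = w.pos p.length := by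
  obtain ⟨r, rfl⟩ := h
  rw [pos_append_left _ le_rfl, pos_length]

lemma vis_subset_of_prefix {p w : Walk} (h : p <+: w) : Vis p ⊆ Vis w := by
  obtain ⟨r, rfl⟩ := h
  exact vis_subset_append p r

lemma prefix_eq_of_endPt_eq {w p p' : Walk} (hw : w.IsSelfAvoiding) (h : p <+: w) (h' : p' <+: w)
    (he : endPt p = endPt p') : p = p' := by
  rw [endPt_of_prefix h, endPt_of_prefix h'] at he
  have := hw _ h.length_le _ h'.length_le he
  rw [List.prefix_iff_eq_take.1 h, List.prefix_iff_eq_take.1 h', this]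

/-- A walk that visits the half-plane `1 ≤ x` first enters it by a step to the east. -/
lemma exists_first_east {u : Walk} {z : ℤ × ℤ} (hz : z ∈ Vis u) (h : 1 ≤ z.1) :
    ∃ v r : Walk, u = v ++ .east :: r ∧ (∀ x ∈ Vis v, x.1 ≤ 0) ∧ (endPt v).1 = 0 := by
  induction u using List.reverseRecOn generalizing z with
  | nil =>
    rw [mem_vis_nil] at hz
    subst hz
    simp at h
  | append_singleton u s ih =>
    by_cases hu : ∃ x ∈ Vis u, 1 ≤ x.1
    · obtain ⟨x, hx, hx1⟩ := hu
      obtain ⟨v, r, rfl, h1, h2⟩ := ih hx hx1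
      exact ⟨v, r ++ [s], by simp, h1, h2⟩
    · push Not at hu
      have he := hu _ (endPt_mem_vis u)
      rcases mem_vis_concat.1 hz with hz | rfl
      · exact absurd h (by have := hu z hz; omega)
      · refine ⟨u, [], ?_, fun x hx => by have := hu x hx; omega, ?_⟩
        · cases s <;> simp [Dir.vec] at h ⊢ <;> omega
        · cases s <;> simp [Dir.vec] at h <;> omega

/-- A walk that leaves the half-plane `1 ≤ x` does so by a step to the west. -/
lemma exists_west_of_leaves {u : Walk} {z : ℤ × ℤ} (hz : z ∈ Vis u) (h : 1 ≤ z.1)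
    (he : (endPt u).1 ≤ 0) : ∃ v r : Walk, u = v ++ .west :: r ∧ (endPt v).1 = 1 := by
  induction u using List.reverseRecOn with
  | nil =>
    rw [mem_vis_nil] at hz
    subst hz
    simp at h
  | append_singleton u s ih =>
    rw [endPt_concat] at he
    have hz : z ∈ Vis u := by
      rcases mem_vis_concat.1 hz with hz | rfl
      · exact hz
      · omega
    by_cases hu : (endPt u).1 ≤ 0
    · obtain ⟨v, r, rfl, h1⟩ := ih hz hu
      exact ⟨v, r ++ [s], by simp, h1⟩
    · refine ⟨u, [], ?_, ?_⟩
      · cases s <;> simp [Dir.vec] at he ⊢ <;> omega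
      · cases s <;> simp [Dir.vec] at he <;> omega

/-! ### Signed area -/

/-- The integral of `x dy` along a walk. -/
def signedArea (v : Walk) : ℤ :=
  ∑ i ∈ Finset.range v.length, (v.pos i).1 * ((v.pos (i + 1)).2 - (v.pos i).2)

@[simp] lemma signedArea_nil : signedArea [] = 0 := rfl

lemma signedArea_concat (v : Walk) (s : Dir) :
    signedArea (v ++ [s]) = signedArea v + (endPt v).1 * s.vec.2 := by
  have hlen : (v ++ [s]).length = v.length + 1 := by simp
  rw [signedArea, hlen, Finset.sum_range_succ]
  congr 1
  · refine Finset.sum_congr rfl fun i hi => ?_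
    rw [Finset.mem_range] at hi
    rw [pos_append_left _ hi.le, pos_append_left _ hi]
  · rw [pos_append_left _ le_rfl, ← hlen, pos_length, pos_length, endPt_concat]
    simp

lemma signedArea_replicate (v : Walk) (k : ℕ) (s : Dir) :
    signedArea (v ++ List.replicate k s) = signedArea v + k * ((endPt v).1 * s.vec.2) := by
  induction k with
  | zero => simp
  | succ k ih =>
    rw [List.replicate_succ', ← List.append_assoc, signedArea_concat, ih]
    -- Along a vertical run `x` is constant, along a horizontal one `dy` vanishes.
    have : s.vec.1 * s.vec.2 = 0 := by cases s <;> rfl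
    rw [endPt_append, endPt_replicate, Prod.fst_add, Prod.smul_fst, nsmul_eq_mul]
    push_cast
    linear_combination (k : ℤ) * this

/-- The closing edge contributes nothing: it is horizontal or lies on `x = 0`. -/
lemma area_eq {w : Walk} {d : Dir} (h : endPt w = d.vec) : w.area = (signedArea w).natAbs := by
  unfold area signedArea
  rw [pos_length, h]
  cases d <;> simp [Dir.vec, pos]

end Walk
end Prudent

namespace Prudent
open Walk

/-! ### Codes of 3-sided walks in the half-plane `x ≤ 0` -/

/-- The letters of a code; see `block` for the steps which they stand for. -/
inductive Sym where
  | dig (d : ℕ)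
  | rise
  | row (p : ℕ)
  | ext

/-- Positions of a 3-sided walk in the half-plane `x ≤ 0`, with box `[-w, 0] × [_, t]`.
In `exc w d t` the walk has just reached the column `x = -w`, at distance `d` below the top row;
in `top w p t` it has just reached the row `y = t`, at abscissa `-p`. -/
inductive St where
  | exc (w d t : ℕ)
  | top (w p t : ℕ)

/-- The letters that may be read in a given state. -/
def Allowed : St → Sym → Prop
  | .exc _ _ _, .dig _ => True
  | .exc _ _ _, .rise => True
  | .top w _ _, .row p' => p' ≤ w
  | .top _ _ _, .ext => True
  | _, _ => False

/-- The vertical run from depth `d` to depth `d'`. -/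
def vert (d d' : ℕ) : Walk := List.replicate (d' - d) .south ++ List.replicate (d - d') .north

/-- The horizontal run from abscissa `-p` to abscissa `-p'`. -/
def horiz (p p' : ℕ) : Walk := List.replicate (p' - p) .west ++ List.replicate (p - p') .east

/-- The steps that a letter stands for. -/
def block : St → Sym → Walk
  | .exc _ d _, .dig d' => vert d d' ++ [.west]
  | .exc _ d _, .rise => List.replicate (d + 1) .north
  | .top _ p _, .row p' => horiz p p' ++ [.north]
  | .top w p _, .ext => List.replicate (w + 1 - p) .west
  | _, _ => []

/-- The state after reading a letter. -/
def next : St → Sym → St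
  | .exc w _ t, .dig d' => .exc (w + 1) d' t
  | .exc w _ t, .rise => .top w w (t + 1)
  | .top w _ t, .row p' => .top w p' (t + 1)
  | .top w _ t, .ext => .exc (w + 1) 0 t
  | st, _ => st

/-- The area that a letter contributes. -/
def letterWeight : St → Sym → ℕ
  | .exc _ _ _, .dig d' => d'
  | .exc w _ _, .rise => w + 1
  | .top _ _ _, .row p' => p' + 1
  | _, _ => 0

/-! A code is a list of letters, the last letter coming first. -/

/-- The state reached by a code. -/
def state : List Sym → St
  | [] => .exc 0 0 0
  | s :: c => next (state c) s

/-- The walk of a code. -/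
def word : List Sym → Walk
  | [] => []
  | s :: c => word c ++ block (state c) s

/-- Each letter of the code is allowed. -/
def Valid : List Sym → Prop
  | [] => True
  | s :: c => Valid c ∧ Allowed (state c) s

/-- The area of a code. -/
def weight : List Sym → ℕ
  | [] => 0
  | s :: c => weight c + letterWeight (state c) s

/-! ### Unique decodability -/

/-- The first entry different from `x` marks the end of the run. -/
lemma replicate_append_cons_inj {α : Type*} {x y y' : α} (hy : y ≠ x) (hy' : y' ≠ x) :
    ∀ {k k' : ℕ} {r r' : List α}, List.replicate k x ++ y :: r = List.replicate k' x ++ y' :: r' →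
      k = k' ∧ y = y' ∧ r = r'
  | 0, 0, r, r', h => by simpa using h
  | 0, k' + 1, r, r', h => by
    simp [List.replicate_succ] at h
    exact absurd h.1 hy
  | k + 1, 0, r, r', h => by
    simp [List.replicate_succ] at h
    exact absurd h.1.symm hy'
  | k + 1, k' + 1, r, r', h => by
    simp only [List.replicate_succ, List.cons_append, List.cons.injEq, true_and] at h
    obtain ⟨h1, h2, h3⟩ := replicate_append_cons_inj hy hy' h
    exact ⟨by rw [h1], h2, h3⟩

lemma replicate_append_cons_ne {α : Type*} {x y : α} (hy : y ≠ x) {k m : ℕ} (hkm : k < m)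
    {r r' : List α} : List.replicate k x ++ y :: r ≠ List.replicate m x ++ r' := by
  intro h
  have h1 : (List.replicate k x ++ y :: r)[k]? = some y := by simp
  rw [h, List.getElem?_append_left (by simpa using hkm)] at h1
  simp [hkm] at h1
  exact hy h1.symm

/-- By truncated subtraction at most one of the two runs is non-empty, so together they encode the
signed displacement from `a`, with `y` as terminator. -/
lemma run_inj {α : Type*} {x x' y : α} (hx : y ≠ x) (hx' : y ≠ x') (hxx : x ≠ x') {a b c : ℕ}
    {r r' : List α}
    (h : (List.replicate (b - a) x ++ List.replicate (a - b) x') ++ y :: r =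
      (List.replicate (c - a) x ++ List.replicate (a - c) x') ++ y :: r') : b = c ∧ r = r' := by
  rcases le_or_gt a b with hb | hb <;> rcases le_or_gt a c with hc | hc
  · simp only [Nat.sub_eq_zero_of_le hb, Nat.sub_eq_zero_of_le hc, List.replicate_zero,
      List.append_nil] at h
    obtain ⟨h1, -, h3⟩ := replicate_append_cons_inj hx hx h
    exact ⟨by omega, h3⟩
  · obtain ⟨m, hm⟩ : ∃ m, a - c = m + 1 := ⟨a - c - 1, by omega⟩
    simp only [Nat.sub_eq_zero_of_le hb, Nat.sub_eq_zero_of_le hc.le, hm, List.replicate_zero,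
      List.append_nil, List.replicate_succ, List.append_assoc, List.cons_append] at h
    exact absurd (replicate_append_cons_inj (k' := 0) hx hxx.symm h).2.1 hx'
  · obtain ⟨m, hm⟩ : ∃ m, a - b = m + 1 := ⟨a - b - 1, by omega⟩
    simp only [Nat.sub_eq_zero_of_le hc, Nat.sub_eq_zero_of_le hb.le, hm, List.replicate_zero,
      List.append_nil, List.replicate_succ, List.append_assoc, List.cons_append] at h
    exact absurd (replicate_append_cons_inj (k := 0) hxx.symm hx h).2.1.symm hx'
  · simp only [Nat.sub_eq_zero_of_le hb.le, Nat.sub_eq_zero_of_le hc.le, List.replicate_zero,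
      List.nil_append] at h
    obtain ⟨h1, -, h3⟩ := replicate_append_cons_inj hx' hx' h
    exact ⟨by omega, h3⟩

/-- A dig starts with at most `d` steps north before another step occurs; a rise has `d + 1`. -/
lemma dig_ne_rise {d d' : ℕ} {r r' : Walk} :
    (vert d d' ++ [.west]) ++ r ≠ List.replicate (d + 1) .north ++ r' := by
  intro h
  rcases le_or_gt d d' with hd | hd
  · simp only [vert, Nat.sub_eq_zero_of_le hd, List.replicate_zero, List.append_nil,
      List.append_assoc, List.singleton_append] at h
    cases hk : d' - d <;> simp [hk, List.replicate_succ] at h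
  · simp only [vert, Nat.sub_eq_zero_of_le hd.le, List.replicate_zero, List.nil_append,
      List.append_assoc, List.singleton_append] at h
    exact replicate_append_cons_ne (by simp) (by omega) h

/-- A row letter stays inside the box, so it has at most `w - p` initial steps west, one fewer than
`ext`. -/
lemma row_ne_ext {w p p' : ℕ} (hp : p ≤ w) (hp' : p' ≤ w) {r r' : Walk} :
    (horiz p p' ++ [.north]) ++ r ≠ List.replicate (w + 1 - p) .west ++ r' := by
  intro h
  rcases le_or_gt p p' with hd | hd
  · simp only [horiz, Nat.sub_eq_zero_of_le hd, List.replicate_zero, List.append_nil,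
      List.append_assoc, List.singleton_append] at h
    exact replicate_append_cons_ne (by simp) (by omega) h
  · obtain ⟨m, hm⟩ : ∃ m, p - p' = m + 1 := ⟨p - p' - 1, by omega⟩
    obtain ⟨n, hn⟩ : ∃ n, w + 1 - p = n + 1 := ⟨w - p, by omega⟩
    simp [horiz, Nat.sub_eq_zero_of_le hd.le, hm, hn, List.replicate_succ] at h

/-- In a state `top w p t` that occurs, `p ≤ w`. -/
def Proper : St → Prop
  | .exc _ _ _ => True
  | .top w p _ => p ≤ w

lemma Proper.next {st : St} (h : Proper st) {s : Sym} (hs : Allowed st s) : Proper (next st s) := by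
  cases st <;> cases s <;> simp_all [Proper, Prudent.next, Allowed]

/-- Distinct letters stand for blocks none of which begins with another one. -/
lemma block_prefix_free {st : St} (hst : Proper st) {a b : Sym} (ha : Allowed st a)
    (hb : Allowed st b) {r r' : Walk} (h : block st a ++ r = block st b ++ r') :
    a = b ∧ r = r' := by
  cases st with
  | exc w d t =>
    cases a <;> cases b <;> simp only [Allowed] at ha hb <;> simp only [block] at h
    · rw [List.append_assoc, List.append_assoc, List.singleton_append, List.singleton_append] at h
      obtain ⟨rfl, rfl⟩ := run_inj (by simp) (by simp) (by simp) h
      exact ⟨rfl, rfl⟩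
    · exact absurd h dig_ne_rise
    · exact absurd h.symm dig_ne_rise
    · exact ⟨rfl, List.append_cancel_left h⟩
  | top w p t =>
    cases a <;> cases b <;> simp only [Allowed] at ha hb <;> simp only [block] at h
    · rw [List.append_assoc, List.append_assoc, List.singleton_append, List.singleton_append] at h
      obtain ⟨rfl, rfl⟩ := run_inj (by simp) (by simp) (by simp) h
      exact ⟨rfl, rfl⟩
    · exact absurd h (row_ne_ext hst ha)
    · exact absurd h.symm (row_ne_ext hst hb)
    · exact ⟨rfl, List.append_cancel_left h⟩

lemma block_ne_nil {st : St} (hst : Proper st) {s : Sym} (hs : Allowed st s) :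
    block st s ≠ [] := by
  cases st <;> cases s <;> simp_all [Allowed, block, Proper]
  omega

/-- The walk of a list of letters in reading order, from a given state. -/
def wordFrom : St → List Sym → Walk
  | _, [] => []
  | st, s :: l => block st s ++ wordFrom (next st s) l

/-- The state that a list of letters in reading order leads to. -/
def stateFrom : St → List Sym → St
  | st, [] => st
  | st, s :: l => stateFrom (next st s) l

/-- The letters of a list in reading order are allowed. -/
def ValidFrom : St → List Sym → Prop
  | _, [] => True
  | st, s :: l => Allowed st s ∧ ValidFrom (next st s) l

/-- Prefix-freeness decodes a walk from its front. Reading order is therefore needed here, although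
codes store their last letter first. -/
lemma wordFrom_injOn (l l' : List Sym) (st : St) (hst : Proper st) (h : ValidFrom st l)
    (h' : ValidFrom st l') (e : wordFrom st l = wordFrom st l') : l = l' := by
  induction l generalizing l' st with
  | nil =>
    cases l' with
    | nil => rfl
    | cons b l' =>
      simp only [wordFrom] at e
      exact absurd (List.append_eq_nil_iff.1 e.symm).1 (block_ne_nil hst h'.1)
  | cons a l ih =>
    cases l' with
    | nil =>
      simp only [wordFrom] at e
      exact absurd (List.append_eq_nil_iff.1 e).1 (block_ne_nil hst h.1)
    | cons b l' =>
      obtain ⟨rfl, e'⟩ := block_prefix_free hst h.1 h'.1 e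
      rw [ih l' _ (hst.next h.1) h.2 h'.2 e']

lemma stateFrom_concat (st : St) (l : List Sym) (s : Sym) :
    stateFrom st (l ++ [s]) = next (stateFrom st l) s := by
  induction l generalizing st with
  | nil => rfl
  | cons a l ih => exact ih _

lemma wordFrom_concat (st : St) (l : List Sym) (s : Sym) :
    wordFrom st (l ++ [s]) = wordFrom st l ++ block (stateFrom st l) s := by
  induction l generalizing st with
  | nil => simp [wordFrom, stateFrom]
  | cons a l ih => simp [wordFrom, stateFrom, ih]

lemma validFrom_concat (st : St) (l : List Sym) (s : Sym) :
    ValidFrom st (l ++ [s]) ↔ ValidFrom st l ∧ Allowed (stateFrom st l) s := by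
  induction l generalizing st with
  | nil => simp [ValidFrom, stateFrom]
  | cons a l ih => simp [ValidFrom, stateFrom, ih, and_assoc]

lemma state_eq (c : List Sym) : state c = stateFrom (.exc 0 0 0) c.reverse := by
  induction c with
  | nil => rfl
  | cons s c ih => rw [List.reverse_cons, stateFrom_concat, ← ih, state]

lemma word_eq (c : List Sym) : word c = wordFrom (.exc 0 0 0) c.reverse := by
  induction c with
  | nil => rfl
  | cons s c ih => rw [List.reverse_cons, wordFrom_concat, ← ih, ← state_eq, word]

lemma valid_iff (c : List Sym) : Valid c ↔ ValidFrom (.exc 0 0 0) c.reverse := by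
  induction c with
  | nil => exact Iff.rfl
  | cons s c ih => rw [List.reverse_cons, validFrom_concat, ← ih, ← state_eq, Valid]

/-- A valid code is determined by its walk. -/
theorem word_injOn : Set.InjOn word {c | Valid c} := by
  intro c hc c' hc' h
  rw [word_eq, word_eq] at h
  exact List.reverse_injective
    (wordFrom_injOn _ _ (.exc 0 0 0) trivial ((valid_iff c).1 hc) ((valid_iff c').1 hc') h)

end Prudent

namespace Prudent
open Walk

/-! ### The walks of codes are 3-sided -/

lemma mem_vis_run {v : Walk} {s : Dir} {k : ℕ} {z : ℤ × ℤ} :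
    z ∈ Vis (v ++ List.replicate k s) ↔ z ∈ Vis v ∨ ∃ j : ℕ, 1 ≤ j ∧ j ≤ k ∧
      z.1 = (endPt v).1 + j * s.vec.1 ∧ z.2 = (endPt v).2 + j * s.vec.2 := by
  simp [mem_vis_replicate, Prod.ext_iff]

/-- What is known about a walk in the state `exc w d t`. -/
structure ExcInv (v : Walk) (w d t : ℕ) : Prop where
  three : IsThreeSided v
  fst : (endPt v).1 = -w
  snd : (endPt v).2 = t - d
  box : ∀ z ∈ Vis v, -(w : ℤ) ≤ z.1 ∧ z.1 ≤ 0 ∧ z.2 ≤ t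
  column : ∀ z ∈ Vis v, z.1 = -w → z.2 = t - d
  start : w = 0 → v = [] ∧ d = 0 ∧ t = 0
  prev : 1 ≤ w → (-(w : ℤ) + 1, (t : ℤ) - d) ∈ Vis v
  top : 1 ≤ w → ∃ z ∈ Vis v, -(w : ℤ) < z.1 ∧ z.2 = t

/-- What is known about a walk in the state `top w p t`. -/
structure TopInv (v : Walk) (w p t : ℕ) : Prop where
  three : IsThreeSided v
  fst : (endPt v).1 = -p
  snd : (endPt v).2 = t
  le : p ≤ w
  pos : 1 ≤ t
  box : ∀ z ∈ Vis v, -(w : ℤ) ≤ z.1 ∧ z.1 ≤ 0 ∧ z.2 ≤ t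
  row : ∀ z ∈ Vis v, z.2 = t → z.1 = -p
  prev : (-(p : ℤ), (t : ℤ) - 1) ∈ Vis v
  west : ∃ z ∈ Vis v, z.1 = -(w : ℤ) ∧ z.2 < t

/-- A walk in column `-w`, all of whose nodes in that column were reached by a vertical run, may
step to the west. -/
lemma ExcInv.dig_run {v : Walk} {w d t : ℕ} (h : ExcInv v w d t) {s : Dir} (hs : s.vec.1 = 0)
    {k d' : ℕ} (hk : (d : ℤ) = d' + k * s.vec.2) :
    ExcInv (v ++ List.replicate k s ++ [.west]) (w + 1) d' t := by
  have hb := h.box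
  have hfst := h.fst
  have hsnd := h.snd
  have hvs : s.vec.2 = 1 ∨ s.vec.2 = -1 := by cases s <;> simp [Dir.vec] at hs ⊢
  have hW : ∀ z ∈ Vis v, (endPt v).1 ≤ z.1 := fun z hz => by have := hb z hz; omega
  -- The end is the only node visited so far in the column `-w`.
  have hf : Free v s := by
    cases s <;> simp [Dir.vec] at hs <;> intro z hz e <;> have := h.column z hz (by omega) <;> omega
  have h3 := h.three.run_vertical hs hf (Or.inl hW) k
  have he1 : (endPt (v ++ List.replicate k s)).1 = -w := by simp [hs, hfst]
  have he2 : (endPt (v ++ List.replicate k s)).2 = t - d' := by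
    simp [hsnd, hk]; ring
  have hV : ∀ z ∈ Vis (v ++ List.replicate k s), -(w : ℤ) ≤ z.1 ∧ z.1 ≤ 0 ∧ z.2 ≤ t := by
    intro z hz
    rcases mem_vis_run.1 hz with hz | ⟨j, hj, hjk, e1, e2⟩
    · exact hb z hz
    · rw [hs] at e1
      refine ⟨by omega, by omega, ?_⟩
      rcases hvs with e | e <;> rw [e] at e2 hk <;> omega
  refine ⟨h3.step_west fun z hz => by have := hV z hz; omega, ?_, ?_, ?_, ?_, by simp, ?_, ?_⟩
  · rw [endPt_concat, Prod.fst_add, he1]; simp [Dir.vec]; omega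
  · rw [endPt_concat, Prod.snd_add, he2]; simp [Dir.vec]
  · intro z hz
    rcases mem_vis_concat.1 hz with hz | rfl
    · have := hV z hz; push_cast; omega
    · rw [Prod.fst_add, Prod.snd_add, he1, he2]; simp [Dir.vec]
  · intro z hz e
    rcases mem_vis_concat.1 hz with hz | rfl
    · have := hV z hz; push_cast at e; omega
    · rw [Prod.snd_add, he2]; simp [Dir.vec]
  · intro _
    refine mem_vis_concat.2 (Or.inl ?_)
    convert endPt_mem_vis (v ++ List.replicate k s) using 1
    ext
    · rw [he1]; push_cast; ring
    · rw [he2]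
  · intro _
    -- If `w = 0` then `v` is empty, and the origin is the required node of the top row.
    rcases Nat.eq_zero_or_pos w with h0 | h0
    · obtain ⟨rfl, rfl, rfl⟩ := h.start h0
      exact ⟨_, zero_mem_vis _, by simp; omega, by simp⟩
    · obtain ⟨z, hz, h1, h2⟩ := h.top h0
      exact ⟨z, vis_subset_of_prefix ⟨List.replicate k s ++ [.west], by simp⟩ hz,
        by push_cast; omega, h2⟩

lemma ExcInv.dig {v : Walk} {w d t : ℕ} (h : ExcInv v w d t) (d' : ℕ) :
    ExcInv (v ++ (vert d d' ++ [.west])) (w + 1) d' t := by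
  rw [← List.append_assoc]
  rcases le_total d d' with hd | hd
  · have := h.dig_run (s := .south) rfl (k := d' - d) (d' := d') (by simp [Dir.vec]; omega)
    simpa [vert, Nat.sub_eq_zero_of_le hd] using this
  · have := h.dig_run (s := .north) rfl (k := d - d') (d' := d') (by simp [Dir.vec]; omega)
    simpa [vert, Nat.sub_eq_zero_of_le hd] using this

lemma ExcInv.rise {v : Walk} {w d t : ℕ} (h : ExcInv v w d t) :
    TopInv (v ++ List.replicate (d + 1) .north) w w (t + 1) := by
  have hb := h.box
  have hfst := h.fst
  have hsnd := h.snd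
  have hW : ∀ z ∈ Vis v, (endPt v).1 ≤ z.1 := fun z hz => by have := hb z hz; omega
  have hf : Free v .north := fun z hz e => by have := h.column z hz (by omega); omega
  have hV : ∀ z ∈ Vis (v ++ List.replicate (d + 1) .north),
      z ∈ Vis v ∨ (z.1 = -w ∧ t - d + 1 ≤ z.2 ∧ z.2 ≤ t + 1) := by
    intro z hz
    rcases mem_vis_run.1 hz with hz | ⟨j, hj, hjk, e1, e2⟩
    · exact Or.inl hz
    · simp [Dir.vec] at e1 e2
      right; omega
  refine ⟨h.three.run_vertical rfl hf (Or.inl hW) _, ?_, ?_, le_rfl, by omega, ?_, ?_, ?_, ?_⟩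
  · simp [hfst, Dir.vec]
  · simp [hsnd, Dir.vec]; ring
  · intro z hz
    rcases hV z hz with hz | hz
    · have := hb z hz; push_cast; omega
    · push_cast; omega
  · intro z hz e
    rcases hV z hz with hz | hz
    · have := hb z hz; push_cast at e; omega
    · omega
  · rw [mem_vis_run]
    -- The node below the new end is the end of `v` if `d = 0`, and otherwise the `d`-th node of the
    -- run.
    rcases Nat.eq_zero_or_pos d with rfl | hd
    · left
      convert endPt_mem_vis v using 1
      ext
      · exact hfst.symm
      · simp [hsnd]
    · right
      exact ⟨d, hd, by omega, by simp [Dir.vec, hfst], by simp [Dir.vec, hsnd]⟩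
  · exact ⟨_, vis_subset_append _ _ (endPt_mem_vis v), hfst, by rw [hsnd]; push_cast; omega⟩

/-- A walk on the top row may run along it and then step to the north. -/
lemma TopInv.row_run {v : Walk} {w p t : ℕ} (h : TopInv v w p t) {s : Dir} (hs : s.vec.2 = 0)
    {k p' : ℕ} (hp' : p' ≤ w) (hk : (p : ℤ) = p' + k * s.vec.1) :
    TopInv (v ++ List.replicate k s ++ [.north]) w p' (t + 1) := by
  have hb := h.box
  have hfst := h.fst
  have hsnd := h.snd
  have hle := h.le
  have hvs : s.vec.1 = 1 ∨ s.vec.1 = -1 := by cases s <;> simp [Dir.vec] at hs ⊢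
  have hN : ∀ z ∈ Vis v, z.2 ≤ (endPt v).2 := fun z hz => by have := hb z hz; omega
  have hf : Free v s := by
    cases s <;> simp [Dir.vec] at hs <;> intro z hz e <;> have := h.row z hz (by omega) <;> omega
  have h3 := h.three.run_horizontal hs hf hN k
  have he1 : (endPt (v ++ List.replicate k s)).1 = -p' := by
    simp [hfst, hk]
  have he2 : (endPt (v ++ List.replicate k s)).2 = t := by simp [hs, hsnd]
  have hV : ∀ z ∈ Vis (v ++ List.replicate k s), -(w : ℤ) ≤ z.1 ∧ z.1 ≤ 0 ∧ z.2 ≤ t := by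
    intro z hz
    rcases mem_vis_run.1 hz with hz | ⟨j, hj, hjk, e1, e2⟩
    · exact hb z hz
    · rw [hs] at e2
      rcases hvs with e | e <;> rw [e] at e1 hk <;> refine ⟨?_, ?_, ?_⟩ <;> omega
  refine ⟨h3.step_north fun z hz => by have := hV z hz; omega, ?_, ?_, hp', by omega, ?_, ?_,
    ?_, ?_⟩
  · rw [endPt_concat, Prod.fst_add, he1]; simp [Dir.vec]
  · rw [endPt_concat, Prod.snd_add, he2]; simp [Dir.vec]
  · intro z hz
    rcases mem_vis_concat.1 hz with hz | rfl
    · have := hV z hz; push_cast; omega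
    · rw [Prod.fst_add, Prod.snd_add, he1, he2]; simp [Dir.vec]; omega
  · intro z hz e
    rcases mem_vis_concat.1 hz with hz | rfl
    · have := hV z hz; push_cast at e; omega
    · rw [Prod.fst_add, he1]; simp [Dir.vec]
  · refine mem_vis_concat.2 (Or.inl ?_)
    convert endPt_mem_vis (v ++ List.replicate k s) using 1
    ext
    · rw [he1]
    · rw [he2]; simp
  · obtain ⟨z, hz, h1, h2⟩ := h.west
    exact ⟨z, vis_subset_of_prefix ⟨List.replicate k s ++ [.north], by simp⟩ hz, h1,
      by push_cast; omega⟩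

lemma TopInv.row_letter {v : Walk} {w p t : ℕ} (h : TopInv v w p t) {p' : ℕ} (hp' : p' ≤ w) :
    TopInv (v ++ (horiz p p' ++ [.north])) w p' (t + 1) := by
  rw [← List.append_assoc]
  rcases le_total p p' with hd | hd
  · have := h.row_run (s := .west) rfl (k := p' - p) hp' (by simp [Dir.vec]; omega)
    simpa [horiz, Nat.sub_eq_zero_of_le hd] using this
  · have := h.row_run (s := .east) rfl (k := p - p') hp' (by simp [Dir.vec]; omega)
    simpa [horiz, Nat.sub_eq_zero_of_le hd] using this

/-- The top row contains a single visited node, so the run is free; its last node is the first one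
in the column `-(w + 1)`, at depth `0`. -/
lemma TopInv.ext_letter {v : Walk} {w p t : ℕ} (h : TopInv v w p t) :
    ExcInv (v ++ List.replicate (w + 1 - p) .west) (w + 1) 0 t := by
  have hb := h.box
  have hfst := h.fst
  have hsnd := h.snd
  have hle := h.le
  have hN : ∀ z ∈ Vis v, z.2 ≤ (endPt v).2 := fun z hz => by have := hb z hz; omega
  have hf : Free v .west := fun z hz e => by have := h.row z hz (by omega); omega
  have hV : ∀ z ∈ Vis (v ++ List.replicate (w + 1 - p) .west),
      z ∈ Vis v ∨ (z.2 = t ∧ -(w : ℤ) - 1 ≤ z.1 ∧ z.1 ≤ -p) := by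
    intro z hz
    rcases mem_vis_run.1 hz with hz | ⟨j, hj, hjk, e1, e2⟩
    · exact Or.inl hz
    · simp [Dir.vec] at e1 e2
      right; omega
  refine ⟨h.three.run_horizontal rfl hf hN _, ?_, ?_, ?_, ?_, by simp, ?_, ?_⟩
  · simp [hfst, Dir.vec]; omega
  · simp [hsnd, Dir.vec]
  · intro z hz
    rcases hV z hz with hz | hz
    · have := hb z hz; push_cast; omega
    · push_cast; omega
  · intro z hz e
    push_cast at e
    rcases hV z hz with hz | hz
    · have := hb z hz; omega
    · simp; omega
  · intro _
    rw [mem_vis_run]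
    rcases Nat.eq_or_lt_of_le hle with hd | hd
    · left
      convert endPt_mem_vis v using 1
      ext
      · rw [hfst, hd]; simp
      · simp [hsnd]
    · right
      refine ⟨w - p, by omega, by omega, ?_, by simp [Dir.vec, hsnd]⟩
      simp [Dir.vec, hfst]; omega
  · intro _
    exact ⟨_, vis_subset_append _ _ (endPt_mem_vis v), by rw [hfst]; push_cast; omega, hsnd⟩

/-- What is known about a walk in a given state. -/
def Inv (v : Walk) : St → Prop
  | .exc w d t => ExcInv v w d t
  | .top w p t => TopInv v w p t

/-- The walk of a valid code is 3-sided and in the state of the code. -/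
theorem inv_word {c : List Sym} (hc : Valid c) : Inv (word c) (state c) := by
  induction c with
  | nil =>
    refine ⟨isThreeSided_nil, by simp [word], by simp [word], ?_, ?_, by simp [word], by simp,
      by simp⟩ <;> intro z hz <;> rw [word, mem_vis_nil] at hz <;> simp [hz]
  | cons s c ih =>
    have hI := ih hc.1
    have hs := hc.2
    rw [word, state]
    cases hst : state c <;> rw [hst] at hI hs <;> cases s <;> simp only [Allowed] at hs
    · exact ExcInv.dig hI _
    · exact ExcInv.rise hI
    · exact TopInv.row_letter hI hs
    · exact TopInv.ext_letter hI

lemma excInv_word {c : List Sym} (hc : Valid c) {w d t : ℕ} (hs : state c = .exc w d t) :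
    ExcInv (word c) w d t := by
  have := inv_word hc
  rwa [hs] at this

lemma topInv_word {c : List Sym} (hc : Valid c) {w p t : ℕ} (hs : state c = .top w p t) :
    TopInv (word c) w p t := by
  have := inv_word hc
  rwa [hs] at this

end Prudent

namespace Prudent
open Walk

/-! ### Every 3-sided walk in the half-plane `x ≤ 0` comes from a code -/

/-- The walk consists of the walk of a code and a part of the next block. -/
inductive Coded (u : Walk) : Prop
  | south (c : List Sym) (w d t j : ℕ) (hc : Valid c) (hst : state c = .exc w d t)
      (hu : u = word c ++ List.replicate j .south)
  | north (c : List Sym) (w d t j : ℕ) (hc : Valid c) (hst : state c = .exc w d t)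
      (hj : 1 ≤ j) (hjd : j ≤ d) (hu : u = word c ++ List.replicate j .north)
  | east (c : List Sym) (w p t j : ℕ) (hc : Valid c) (hst : state c = .top w p t)
      (hjp : j ≤ p) (hu : u = word c ++ List.replicate j .east)
  | west (c : List Sym) (w p t j : ℕ) (hc : Valid c) (hst : state c = .top w p t)
      (hj : 1 ≤ j) (hjw : p + j ≤ w) (hu : u = word c ++ List.replicate j .west)

/-- Reversing a non-empty run would revisit its penultimate node. -/
lemma not_adm_back {v : Walk} {s s' : Dir} (hss : s'.vec = -s.vec) {j : ℕ} (hj : 1 ≤ j)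
    (h : Adm (v ++ List.replicate j s) s') : False := by
  obtain ⟨i, rfl⟩ : ∃ i, j = i + 1 := ⟨j - 1, by omega⟩
  refine h.endPt_notMem ?_
  have : endPt (v ++ List.replicate (i + 1) s) + s'.vec = endPt (v ++ List.replicate i s) := by
    simp only [endPt_append, endPt_replicate, hss, add_smul, one_smul]
    abel
  rw [this, List.replicate_succ', ← List.append_assoc]
  exact vis_subset_append _ _ (endPt_mem_vis _)

/-- Each column of the box has been visited below the top row. -/
lemma TopInv.exists_below {v : Walk} {w p t : ℕ} (h : TopInv v w p t) {x : ℤ} (h1 : -(w : ℤ) ≤ x)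
    (h2 : x ≤ 0) (hx : x ≠ -p) : ∃ z ∈ Vis v, z.1 = x ∧ z.2 < t := by
  obtain ⟨z, hz, hz1, -⟩ := h.west
  obtain ⟨y, hy, rfl⟩ := exists_vis_column hz (zero_mem_vis v) (hz1.le.trans h1) h2
  refine ⟨y, hy, rfl, lt_of_le_of_ne (h.box y hy).2.2 fun e => hx (h.row y hy e)⟩

/-- An admissible step starts or prolongs a run, or completes a letter. The only other candidates
are reversals and turning back to the east, and both are excluded. -/
lemma Coded.concat_of_south {u : Walk} {s : Dir} (h3 : IsThreeSided u) (ha : Adm u s)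
    (hx : (endPt u + s.vec).1 ≤ 0) {c : List Sym} {w d t j : ℕ} (hc : Valid c)
    (hst : state c = .exc w d t) (hu : u = word c ++ List.replicate j .south) :
    Coded (u ++ [s]) := by
  have I := excInv_word hc hst
  have hfst := I.fst
  have hsnd := I.snd
  have sub : Vis (word c) ⊆ Vis u := hu ▸ vis_subset_append _ _
  have he1 : (endPt u).1 = -w := by simp [hu, Dir.vec, hfst]
  have he2 : (endPt u).2 = t - d - j := by simp [hu, Dir.vec, hsnd]; ring
  cases s with
  | north =>
    rcases Nat.eq_zero_or_pos j with rfl | hj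
    · rcases Nat.eq_zero_or_pos d with rfl | hd
      · refine .east (.rise :: c) w w (t + 1) 0 ⟨hc, ?_⟩ ?_ (Nat.zero_le _) ?_
        · rw [hst]; trivial
        · rw [state, hst]; rfl
        · simp [hu, word, hst, block]
      · exact .north c w d t 1 hc hst le_rfl hd (by simp [hu])
    · exact (not_adm_back (by simp [Dir.vec]) hj (hu ▸ ha)).elim
  | south => exact .south c w d t (j + 1) hc hst (by simp [hu, List.replicate_succ'])
  | west =>
    refine .south (.dig (d + j) :: c) (w + 1) (d + j) t 0 ⟨hc, ?_⟩ ?_ ?_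
    · rw [hst]; trivial
    · rw [state, hst]; rfl
    · simp [hu, word, hst, block, vert]
  | east =>
    exfalso
    rw [Prod.fst_add, he1] at hx
    simp only [Dir.vec] at hx
    obtain ⟨z, hz, hz1, hz2⟩ := I.top (by omega)
    -- On the top row the eastern neighbour is the node from which the column was entered. Below it,
    -- a step east would have to leave the box, but the top row has a visited node further east.
    rcases Nat.eq_zero_or_pos (d + j) with h0 | h0
    · refine ha.endPt_notMem (sub ?_)
      convert I.prev (by omega) using 1
      ext
      · rw [Prod.fst_add, he1]; rfl
      · rw [Prod.snd_add, he2]; simp [Dir.vec]; omega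
    · have := ha.east_extends h3 (sub hz) (by omega) z (sub hz)
      omega

lemma Coded.concat_of_north {u : Walk} {s : Dir} (h3 : IsThreeSided u) (ha : Adm u s)
    {c : List Sym} {w d t j : ℕ} (hc : Valid c)
    (hst : state c = .exc w d t) (hj : 1 ≤ j) (hjd : j ≤ d)
    (hu : u = word c ++ List.replicate j .north) :
    Coded (u ++ [s]) := by
  have I := excInv_word hc hst
  have hfst := I.fst
  have hsnd := I.snd
  have sub : Vis (word c) ⊆ Vis u := hu ▸ vis_subset_append _ _
  have he1 : (endPt u).1 = -w := by simp [hu, Dir.vec, hfst]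
  have he2 : (endPt u).2 = t - d + j := by simp [hu, Dir.vec, hsnd]
  have hw : 1 ≤ w := by
    by_contra hw
    have := I.start (by omega)
    omega
  cases s with
  | north =>
    rcases Nat.eq_or_lt_of_le hjd with rfl | hlt
    · refine .east (.rise :: c) w w (t + 1) 0 ⟨hc, ?_⟩ ?_ (Nat.zero_le _) ?_
      · rw [hst]; trivial
      · rw [state, hst]; rfl
      · simp [hu, word, hst, block, List.replicate_succ']
    · exact .north c w d t (j + 1) hc hst (by omega) hlt (by simp [hu, List.replicate_succ'])
  | south => exact (not_adm_back (by simp [Dir.vec]) hj (hu ▸ ha)).elim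
  | west =>
    refine .south (.dig (d - j) :: c) (w + 1) (d - j) t 0 ⟨hc, ?_⟩ ?_ ?_
    · rw [hst]; trivial
    · rw [state, hst]; rfl
    · have e1 : d - j - d = 0 := by omega
      have e2 : d - (d - j) = j := by omega
      simp [hu, word, hst, block, vert, e1, e2]
  | east =>
    exfalso
    obtain ⟨z, hz, hz1, hz2⟩ := I.top hw
    -- On the top row the node `z` blocks the half-line to the east; below it, `z` contradicts
    -- `Adm.east_extends`.
    rcases Nat.eq_or_lt_of_le hjd with rfl | hlt
    · have := ha.free z (sub hz) (by omega)
      omega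
    · have := ha.east_extends h3 (sub hz) (by omega) z (sub hz)
      omega

lemma Coded.concat_of_east {u : Walk} {s : Dir} (ha : Adm u s)
    (hx : (endPt u + s.vec).1 ≤ 0) {c : List Sym} {w p t j : ℕ} (hc : Valid c)
    (hst : state c = .top w p t) (hjp : j ≤ p) (hu : u = word c ++ List.replicate j .east) :
    Coded (u ++ [s]) := by
  have I := topInv_word hc hst
  have hfst := I.fst
  have hsnd := I.snd
  have hle := I.le
  have sub : Vis (word c) ⊆ Vis u := hu ▸ vis_subset_append _ _
  have he1 : (endPt u).1 = -p + j := by simp [hu, Dir.vec, hfst]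
  have he2 : (endPt u).2 = t := by simp [hu, Dir.vec, hsnd]
  cases s with
  | north =>
    refine .east (.row (p - j) :: c) w (p - j) (t + 1) 0 ⟨hc, ?_⟩ ?_ (Nat.zero_le _) ?_
    · rw [hst, Allowed]; omega
    · rw [state, hst]; rfl
    · have e1 : p - j - p = 0 := by omega
      have e2 : p - (p - j) = j := by omega
      simp [hu, word, hst, block, horiz, e1, e2]
  | east =>
    rw [Prod.fst_add, he1] at hx
    simp only [Dir.vec] at hx
    exact .east c w p t (j + 1) hc hst (by omega) (by simp [hu, List.replicate_succ'])
  | west =>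
    rcases Nat.eq_zero_or_pos j with rfl | hj
    · rcases Nat.eq_or_lt_of_le hle with rfl | hlt
      · refine .south (.ext :: c) (p + 1) 0 t 0 ⟨hc, ?_⟩ ?_ ?_
        · rw [hst]; trivial
        · rw [state, hst]; rfl
        · have e1 : p + 1 - p = 1 := by omega
          simp [hu, word, hst, block, e1]
      · exact .west c w p t 1 hc hst le_rfl hlt (by simp [hu])
    · exact (not_adm_back (by simp [Dir.vec]) hj (hu ▸ ha)).elim
  | south =>
    exfalso
    -- For `j = 0` the southern neighbour is the preceding node; otherwise the column has been
    -- visited further down, so the half-line to the south is not free.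
    rcases Nat.eq_zero_or_pos j with rfl | hj
    · refine ha.endPt_notMem (sub ?_)
      convert I.prev using 1
      ext
      · rw [Prod.fst_add, he1]; simp [Dir.vec]
      · rw [Prod.snd_add, he2]; rfl
    · obtain ⟨z, hz, hz1, hz2⟩ := I.exists_below (x := -p + j) (by omega) (by omega) (by omega)
      have := ha.free z (sub hz) (by omega)
      omega

lemma Coded.concat_of_west {u : Walk} {s : Dir} (ha : Adm u s)
    {c : List Sym} {w p t j : ℕ} (hc : Valid c)
    (hst : state c = .top w p t) (hj : 1 ≤ j) (hjw : p + j ≤ w)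
    (hu : u = word c ++ List.replicate j .west) :
    Coded (u ++ [s]) := by
  have I := topInv_word hc hst
  have hfst := I.fst
  have hsnd := I.snd
  have sub : Vis (word c) ⊆ Vis u := hu ▸ vis_subset_append _ _
  have he1 : (endPt u).1 = -p - j := by simp [hu, Dir.vec, hfst]; ring
  have he2 : (endPt u).2 = t := by simp [hu, Dir.vec, hsnd]
  cases s with
  | north =>
    refine .east (.row (p + j) :: c) w (p + j) (t + 1) 0 ⟨hc, ?_⟩ ?_ (Nat.zero_le _) ?_
    · rw [hst, Allowed]; omega
    · rw [state, hst]; rfl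
    · simp [hu, word, hst, block, horiz]
  | west =>
    rcases Nat.eq_or_lt_of_le hjw with rfl | hlt
    · refine .south (.ext :: c) (p + j + 1) 0 t 0 ⟨hc, ?_⟩ ?_ ?_
      · rw [hst]; trivial
      · rw [state, hst]; rfl
      · have e1 : p + j + 1 - p = j + 1 := by omega
        simp [hu, word, hst, block, e1, List.replicate_succ']
    · exact .west c w p t (j + 1) hc hst (by omega) (by omega) (by simp [hu, List.replicate_succ'])
  | east => exact (not_adm_back (by simp [Dir.vec]) hj (hu ▸ ha)).elim
  | south =>
    exfalso
    obtain ⟨z, hz, hz1, hz2⟩ := I.exists_below (x := -p - j) (by omega) (by omega) (by omega)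
    have := ha.free z (sub hz) (by omega)
    omega

/-- Every 3-sided walk in the half-plane `x ≤ 0` comes from a code. -/
theorem coded_of_isThreeSided {u : Walk} (h : IsThreeSided u) (hx : ∀ z ∈ Vis u, z.1 ≤ 0) :
    Coded u := by
  induction u using List.reverseRecOn with
  | nil => exact .south [] 0 0 0 0 trivial rfl rfl
  | append_singleton u s ih =>
    obtain ⟨h3, ha⟩ := isThreeSided_concat.1 h
    have hx' := hx _ (mem_vis_concat.2 (Or.inr rfl))
    rcases ih h3 fun z hz => hx z (mem_vis_concat.2 (Or.inl hz)) with
      ⟨c, w, d, t, j, hc, hst, hu⟩ | ⟨c, w, d, t, j, hc, hst, hj, hjd, hu⟩ |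
      ⟨c, w, p, t, j, hc, hst, hjp, hu⟩ | ⟨c, w, p, t, j, hc, hst, hj, hjw, hu⟩
    · exact .concat_of_south h3 ha hx' hc hst hu
    · exact .concat_of_north h3 ha hc hst hj hjd hu
    · exact .concat_of_east ha hx' hc hst hjp hu
    · exact .concat_of_west ha hc hst hj hjw hu

end Prudent

namespace Prudent

/-! ### Reflection in the vertical axis -/

/-- Reflection of a step in the vertical axis. -/
def Dir.mirror : Dir → Dir
  | .north => .north
  | .east => .west
  | .south => .south
  | .west => .east

lemma Dir.vec_mirror_fst (s : Dir) : s.mirror.vec.1 = -s.vec.1 := by cases s <;> rfl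

lemma Dir.vec_mirror_snd (s : Dir) : s.mirror.vec.2 = s.vec.2 := by cases s <;> rfl

lemma Dir.mirror_mirror (s : Dir) : s.mirror.mirror = s := by cases s <;> rfl

namespace Walk

/-- Reflection of a walk in the vertical axis. -/
def mirror (v : Walk) : Walk := v.map Dir.mirror

lemma mirror_mirror (v : Walk) : mirror (mirror v) = v := by
  simp [mirror, Function.comp_def, Dir.mirror_mirror]

lemma mirror_injective : Function.Injective mirror :=
  Function.LeftInverse.injective mirror_mirror

@[simp] lemma length_mirror (v : Walk) : (mirror v).length = v.length := by simp [mirror]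

lemma mirror_concat (v : Walk) (s : Dir) : mirror (v ++ [s]) = mirror v ++ [s.mirror] := by
  simp [mirror]

lemma endPt_mirror (v : Walk) : endPt (mirror v) = (-(endPt v).1, (endPt v).2) := by
  induction v using List.reverseRecOn with
  | nil => rfl
  | append_singleton v s ih =>
    rw [mirror_concat, endPt_concat, endPt_concat, ih]
    ext
    · simp [Dir.vec_mirror_fst]; ring
    · simp [Dir.vec_mirror_snd]

lemma pos_mirror (v : Walk) (i : ℕ) : pos (mirror v) i = (-(pos v i).1, (pos v i).2) := by
  have : pos (mirror v) i = endPt (mirror (v.take i)) := by simp [pos, endPt, mirror, List.map_take]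
  rw [this, endPt_mirror]
  rfl

lemma mem_vis_mirror {v : Walk} {z : ℤ × ℤ} : z ∈ Vis (mirror v) ↔ (-z.1, z.2) ∈ Vis v := by
  simp only [Vis, Set.mem_ofPred_eq, length_mirror, pos_mirror, Prod.ext_iff]
  refine exists_congr fun i => and_congr_right fun _ => ?_
  simp only [neg_eq_iff_eq_neg]

lemma Adm.mirror {v : Walk} {s : Dir} (h : Adm v s) : Adm (mirror v) s.mirror := by
  have e1 : (endPt v + s.vec).1 = -(endPt (Walk.mirror v) + s.mirror.vec).1 := by
    simp [endPt_mirror, Dir.vec_mirror_fst]; ring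
  have e2 : (endPt v + s.vec).2 = (endPt (Walk.mirror v) + s.mirror.vec).2 := by
    simp [endPt_mirror, Dir.vec_mirror_snd]
  have f1 : (endPt v).1 = -(endPt (Walk.mirror v)).1 := by simp [endPt_mirror]
  have f2 : (endPt v).2 = (endPt (Walk.mirror v)).2 := by simp [endPt_mirror]
  refine ⟨?_, ?_, ?_⟩
  · have hf := h.free
    cases s <;> intro z hz e <;> have := hf _ (mem_vis_mirror.1 hz) (by simp; omega) <;>
      simp at this <;> omega
  · rcases h.side with k | k | k
    · left
      intro z hz
      have := k _ (mem_vis_mirror.1 hz)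
      simp only at this
      omega
    · right; right
      intro z hz
      have := k _ (mem_vis_mirror.1 hz)
      simp only at this
      omega
    · right; left
      intro z hz
      have := k _ (mem_vis_mirror.1 hz)
      simp only at this
      omega
  · rintro ⟨h1, ⟨z, hz, hz1⟩, h3, h4, y, hy, hy2⟩
    have tr : ∀ {x}, x ∈ Vis v → (-x.1, x.2) ∈ Vis (Walk.mirror v) := fun hx =>
      mem_vis_mirror.2 (by simpa using hx)
    refine h.cross ⟨by omega, ⟨_, mem_vis_mirror.1 hz, by simp only; omega⟩, ?_, ?_,
      ⟨_, mem_vis_mirror.1 hy, by simp only; omega⟩⟩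
    · intro x hx
      have := h3 _ (tr hx)
      simp only at this
      omega
    · intro x hx
      have := h4 _ (tr hx)
      simp only at this
      omega

lemma IsThreeSided.mirror {v : Walk} (h : IsThreeSided v) : IsThreeSided (mirror v) := by
  induction v using List.reverseRecOn with
  | nil => exact h
  | append_singleton v s ih =>
    rw [isThreeSided_concat] at h
    rw [mirror_concat, isThreeSided_concat]
    exact ⟨ih h.1, h.2.mirror⟩

/-- Reflection changes the sign of `∮ x dy`, and the area is its absolute value. -/
lemma area_mirror (v : Walk) : area (mirror v) = area v := by
  unfold area
  rw [← Int.natAbs_neg]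
  congr 1
  simp only [length_mirror, pos_mirror, neg_add, ← Finset.sum_neg_distrib]
  congr 1
  · exact Finset.sum_congr rfl fun i _ => by ring
  · ring

end Walk

lemma mirror_mem {n : ℕ} {w : Walk} (h : w ∈ threeSidedPolygons n) :
    w.mirror ∈ threeSidedPolygons n := by
  obtain ⟨⟨h1, h2, d, h3⟩, h4, h5⟩ := h
  refine ⟨⟨h4.mirror.1.1, by simpa using h2, d.mirror, ?_⟩, h4.mirror, ?_⟩
  · rw [Walk.length_mirror, Walk.pos_mirror, h3]
    ext
    · exact (Dir.vec_mirror_fst d).symm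
    · exact (Dir.vec_mirror_snd d).symm
  · rw [Walk.area_mirror, h5]

open Walk

/-! ### Three families of polygons -/

/-- The area enclosed between a walk in the state `st` and the line `x = 1`. -/
def signedWeight (a : ℕ) : St → ℤ
  | .exc w d _ => a - (w + 1) * d
  | .top _ _ _ => a

/-- The left-hand side is the integral of `(1 - x) dy`. At depth `d` in the column `-w` it falls
short of the weight by `(w + 1) * d`, which the climb back to the top row would restore. -/
lemma signedArea_word {c : List Sym} (hc : Valid c) :
    (endPt (word c)).2 - signedArea (word c) = signedWeight (weight c) (state c) := by
  induction c with
  | nil => simp [word, weight, state, signedWeight]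
  | cons s c ih =>
    have hI := inv_word hc.1
    have ih := ih hc.1
    have hs := hc.2
    rw [word, state, weight]
    cases hst : state c <;> rw [hst] at hI hs ih <;> cases s <;> simp only [Allowed] at hs
    case exc.dig w d t d' =>
      have h1 := hI.fst
      simp only [block, vert, next, letterWeight, signedWeight] at ih ⊢
      rw [← List.append_assoc, signedArea_concat, ← List.append_assoc, signedArea_replicate,
        signedArea_replicate]
      simp [h1, Dir.vec]
      rcases le_total d d' with h | h
      · rw [Nat.sub_eq_zero_of_le h, Nat.cast_sub h]
        push_cast
        linear_combination ih
      · rw [Nat.sub_eq_zero_of_le h, Nat.cast_sub h]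
        push_cast
        linear_combination ih
    case exc.rise w d t =>
      have h1 := hI.fst
      simp only [block, next, letterWeight, signedWeight] at ih ⊢
      rw [signedArea_replicate]
      simp [h1, Dir.vec]
      linear_combination ih
    case top.row w p t p' =>
      have h1 := hI.fst
      simp only [block, horiz, next, letterWeight, signedWeight] at ih ⊢
      rw [← List.append_assoc, signedArea_concat, ← List.append_assoc, signedArea_replicate,
        signedArea_replicate]
      simp [h1, Dir.vec]
      rcases le_total p p' with h | h
      · rw [Nat.sub_eq_zero_of_le h, Nat.cast_sub h]
        push_cast
        linear_combination ih
      · rw [Nat.sub_eq_zero_of_le h, Nat.cast_sub h]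
        push_cast
        linear_combination ih
    case top.ext w p t =>
      simp only [block, next, letterWeight, signedWeight] at ih ⊢
      rw [signedArea_replicate]
      simp [Dir.vec]
      linear_combination ih

/-- The polygon of a code that leads to a state `top w p t`: the walk continues on the top row to
the column `x = 1` and returns there to the level of the origin. -/
def closing (c : List Sym) : Walk :=
  match state c with
  | .top _ p t => word c ++ List.replicate (p + 1) .east ++ List.replicate t .south
  | .exc _ _ _ => []

/-- The polygon that is a single column, described counterclockwise. -/
def columnPolygon (n : ℕ) : Walk :=
  List.replicate n .south ++ [.east] ++ List.replicate n .north

/-- The polygon consisting of columns of depths `d + 1`, hanging from the row `y = 1`. -/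
def hanging (ds : List ℕ) : Walk :=
  word (.rise :: ds.map .dig) ++ List.replicate ds.length .east

lemma mem_of_isThreeSided {w : Walk} (h : IsThreeSided w) (hl : w.length ≠ 1) {d : Dir}
    (hd : endPt w = d.vec) {n : ℕ} (hn : (signedArea w).natAbs = n) :
    w ∈ threeSidedPolygons n :=
  ⟨⟨h.1.1, hl, d, by rw [pos_length, hd]⟩, h, by rw [area_eq hd, hn]⟩

lemma endPt_closing {c : List Sym} (hc : Valid c) {w p t : ℕ} (hst : state c = .top w p t) :
    endPt (closing c) = (1, 0) := by
  have I := topInv_word hc hst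
  simp only [closing, hst]
  ext
  · simp [I.fst, Dir.vec]
  · simp [I.snd, Dir.vec]

lemma closing_mem {c : List Sym} (hc : Valid c) {w p t : ℕ} (hst : state c = .top w p t) :
    closing c ∈ threeSidedPolygons (weight c) := by
  have I := topInv_word hc hst
  have hfst := I.fst
  have hsnd := I.snd
  have hpos := I.pos
  have hE := endPt_closing hc hst
  have hA := signedArea_word hc
  rw [hst] at hA
  simp only [signedWeight] at hA
  simp only [closing, hst] at hE ⊢
  have h1 : IsThreeSided (word c ++ List.replicate (p + 1) .east) :=
    I.three.run_horizontal rfl (fun z hz e => by have := I.row z hz (by omega); omega)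
      (fun z hz => by have := I.box z hz; omega) _
  have e1 : (endPt (word c ++ List.replicate (p + 1) .east)).1 = 1 := by simp [hfst, Dir.vec]
  have e2 : (endPt (word c ++ List.replicate (p + 1) .east)).2 = t := by simp [hsnd, Dir.vec]
  have h2 : ∀ z ∈ Vis (word c ++ List.replicate (p + 1) .east), z.1 ≤ 1 ∧ (z.1 = 1 → z.2 = t) := by
    intro z hz
    rcases mem_vis_run.1 hz with hz | ⟨j, hj, hjk, k1, k2⟩
    · have := I.box z hz
      omega
    · simp [Dir.vec] at k1 k2
      omega
  refine mem_of_isThreeSided (d := .east) (h1.run_vertical rfl ?_ (Or.inr ?_) _) ?_ hE ?_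
  · intro z hz e
    have := (h2 z hz).2 (by omega)
    omega
  · intro z hz
    have := (h2 z hz).1
    omega
  · simp; omega
  -- The run down `x = 1` contributes `-t`, which cancels the ordinate of the end of `word c` and
  -- leaves `-weight c`.
  · rw [signedArea_replicate, signedArea_replicate, e1]
    simp [Dir.vec]
    omega

lemma endPt_columnPolygon (n : ℕ) : endPt (columnPolygon n) = (1, 0) := by
  ext <;> simp [columnPolygon, endPt, Dir.vec]

lemma columnPolygon_mem {n : ℕ} (hn : 1 ≤ n) : columnPolygon n ∈ threeSidedPolygons n := by
  have v0 : ∀ z ∈ Vis ([] ++ List.replicate n Dir.south), z.1 = 0 := by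
    intro z hz
    rcases mem_vis_run.1 hz with hz | ⟨j, hj, hjk, k1, k2⟩
    · rw [mem_vis_nil] at hz; simp [hz]
    · simpa [Dir.vec] using k1
  have h0 : IsThreeSided ([] ++ List.replicate n .south) :=
    isThreeSided_nil.run_vertical rfl (fun z hz _ => by rw [mem_vis_nil] at hz; simp [hz])
      (Or.inl fun z hz => by rw [mem_vis_nil] at hz; simp [hz]) n
  have h1 := h0.step_east fun z hz => by rw [v0 z hz]; simp [Dir.vec]
  have e1 : (endPt ([] ++ List.replicate n .south ++ [.east])).1 = 1 := by simp [Dir.vec]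
  have h2 : ∀ z ∈ Vis ([] ++ List.replicate n .south ++ [.east]),
      z.1 ≤ 1 ∧ (z.1 = 1 → z = endPt ([] ++ List.replicate n .south ++ [.east])) := by
    intro z hz
    rcases mem_vis_concat.1 hz with hz | rfl
    · have := v0 z hz
      exact ⟨by omega, fun h => by omega⟩
    · refine ⟨?_, fun _ => (endPt_concat _ _).symm⟩
      simp [Dir.vec]
  refine mem_of_isThreeSided (d := .east) ?_ ?_ (endPt_columnPolygon n) ?_
  · have := h1.run_vertical (s := .north) rfl (fun z hz e => ?_) (Or.inr fun z hz => ?_) n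
    · simpa [columnPolygon] using this
    · rw [(h2 z hz).2 (by omega)]
    · have := (h2 z hz).1
      omega
  · simp [columnPolygon]; omega
  · have : columnPolygon n = [] ++ List.replicate n .south ++ [.east] ++ List.replicate n .north :=
      by simp [columnPolygon]
    rw [this, signedArea_replicate, signedArea_concat, signedArea_replicate, e1]
    simp [Dir.vec]

lemma state_digs (ds : List ℕ) : ∃ d, state (ds.map .dig) = .exc ds.length d 0 := by
  induction ds with
  | nil => exact ⟨0, rfl⟩
  | cons d ds ih =>
    obtain ⟨d', h⟩ := ih
    exact ⟨d, by rw [List.map_cons, state, h]; rfl⟩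

lemma valid_digs (ds : List ℕ) : Valid (ds.map .dig) := by
  induction ds with
  | nil => trivial
  | cons d ds ih =>
    obtain ⟨d', h⟩ := state_digs ds
    exact ⟨ih, by rw [h]; trivial⟩

lemma weight_digs (ds : List ℕ) : weight (ds.map .dig) = ds.sum := by
  induction ds with
  | nil => rfl
  | cons d ds ih =>
    obtain ⟨d', h⟩ := state_digs ds
    rw [List.map_cons, weight, h, ih, List.sum_cons, letterWeight, add_comm]

lemma valid_rise_digs (ds : List ℕ) : Valid (.rise :: ds.map .dig) := by
  obtain ⟨d, h⟩ := state_digs ds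
  exact ⟨valid_digs ds, by rw [h]; trivial⟩

lemma state_rise_digs (ds : List ℕ) :
    state (.rise :: ds.map .dig) = .top ds.length ds.length 1 := by
  obtain ⟨d, h⟩ := state_digs ds
  rw [state, h]
  rfl

lemma endPt_hanging (ds : List ℕ) : endPt (hanging ds) = (0, 1) := by
  have I := topInv_word (valid_rise_digs ds) (state_rise_digs ds)
  ext
  · simp [hanging, I.fst, Dir.vec]
  · simp [hanging, I.snd, Dir.vec]

lemma hanging_mem {ds : List ℕ} (hds : ds ≠ []) :
    hanging ds ∈ threeSidedPolygons (ds.sum + ds.length) := by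
  have I := topInv_word (valid_rise_digs ds) (state_rise_digs ds)
  have hA := signedArea_word (valid_rise_digs ds)
  have hfst := I.fst
  have hsnd := I.snd
  have hlen : 1 ≤ ds.length := List.length_pos_iff.2 hds
  obtain ⟨d, hd⟩ := state_digs ds
  rw [state_rise_digs, weight, weight_digs, hd] at hA
  simp only [signedWeight, letterWeight] at hA
  refine mem_of_isThreeSided (d := .north) ?_ ?_ (endPt_hanging ds) ?_
  · exact I.three.run_horizontal rfl (fun z hz e => by have := I.row z hz (by omega); omega)
      (fun z hz => by have := I.box z hz; omega) _
  · rw [hanging, word, hd, block]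
    simp; omega
  -- The weight of the rise includes the cell between `x = 0` and `x = 1`. This polygon closes along
  -- `x = 0`, so its area is one less than the weight of the code.
  · rw [hanging, signedArea_replicate]
    generalize ds.sum = a at hA ⊢
    simp [Dir.vec]
    push_cast at hA hsnd
    omega

end Prudent

namespace Prudent
open Walk

/-! ### Classification of 3-sided prudent polygons -/

/-- A polygon that ends at `(1, 0)` consists of its part in `x ≤ 0`, a step to the east and
a straight run back to the level of the origin. -/
lemma eq_append_run {w v : Walk} {s : Dir} {n : ℕ} (h : IsThreeSided w)
    (hx : ∀ z ∈ Vis w, z.1 ≤ 1) (he : endPt w = (1, 0)) (hp : v ++ [.east] <+: w)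
    (hv : ∀ z ∈ Vis v, z.1 ≤ 0)
    (hs : s = .south ∧ endPt v = (0, (n : ℤ)) ∨ s = .north ∧ endPt v = (0, -(n : ℤ))) :
    w = v ++ [.east] ++ List.replicate n s := by
  -- The run is peeled off from the end of the walk, one step at a time.
  have key : ∀ i ≤ n, ∃ u : Walk, w = u ++ List.replicate i s := by
    intro i
    induction i with
    | zero => exact fun _ => ⟨w, by simp⟩
    | succ i ih =>
      intro hi
      obtain ⟨u, hu⟩ := ih (by omega)
      have hew : endPt u + i • s.vec = (1, 0) := by rw [← he, hu]; simp
      have hew1 := congrArg Prod.fst hew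
      have hew2 := congrArg Prod.snd hew
      have hev : (endPt v).1 = 0 := by rcases hs with ⟨-, e⟩ | ⟨-, e⟩ <;> rw [e]
      have huw : u <+: w := ⟨_, hu.symm⟩
      have hne : u ≠ v ++ [.east] := by
        rintro rfl
        rw [endPt_concat] at hew2
        rcases hs with ⟨rfl, e⟩ | ⟨rfl, e⟩ <;> rw [e] at hew2 <;> simp [Dir.vec] at hew2 <;> omega
      have hu1 : (endPt u).1 = 1 := by
        rcases hs with ⟨rfl, e⟩ | ⟨rfl, e⟩ <;> simpa [Dir.vec] using hew1
      have hvu : v ++ [.east] <+: u := by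
        rcases List.prefix_or_prefix_of_prefix hp huw with h' | h'
        · exact h'
        · rcases List.prefix_concat_iff.1 h' with h' | h'
          · exact absurd h' hne
          · have := hv _ (vis_subset_of_prefix h' (endPt_mem_vis u))
            omega
      rcases List.eq_nil_or_concat' u with rfl | ⟨u', r, rfl⟩
      · simp at hu1
      have hvu' : v ++ [.east] <+: u' := by
        rcases List.prefix_concat_iff.1 hvu with h' | h'
        · exact absurd h'.symm hne
        · exact h'
      have hm : endPt (v ++ [.east]) ∈ Vis u' := vis_subset_of_prefix hvu' (endPt_mem_vis _)
      have h3 : IsThreeSided (u' ++ [r]) := (hu ▸ h).of_append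
      obtain ⟨h3', ha⟩ := isThreeSided_concat.1 h3
      have hx' : (endPt u').1 ≤ 1 := hx _ (vis_subset_of_prefix
        ((List.prefix_append u' [r]).trans huw) (endPt_mem_vis u'))
      have hzero := zero_mem_vis u'
      rw [endPt_concat] at hm hew2 hu1
      refine ⟨u', ?_⟩
      suffices r = s by
        rw [hu, this, List.replicate_succ, List.append_assoc]; rfl
      -- The node where the walk first entered `x = 1` rules out the other steps: a vertical step
      -- the wrong way would point at it, and a step east below the top row would have to leave the
      -- box. A step west would come from `x = 2`.
      rcases hs with ⟨rfl, e⟩ | ⟨rfl, e⟩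
      · have m1 : (endPt v + Dir.east.vec).1 = 1 := by simp [e, Dir.vec]
        have m2 : (endPt v + Dir.east.vec).2 = n := by simp [e, Dir.vec]
        cases r <;> simp [Dir.vec] at hew2 hu1
        · have := ha.free _ hm (by omega)
          omega
        · have := ha.east_extends h3' hm (by omega) _ hm
          omega
        · rfl
        · omega
      · have m1 : (endPt v + Dir.east.vec).1 = 1 := by simp [e, Dir.vec]
        have m2 : (endPt v + Dir.east.vec).2 = -n := by simp [e, Dir.vec]
        cases r <;> simp [Dir.vec] at hew2 hu1
        · rfl
        -- In the northward case at level `0`, a step east would start at the origin, so nothing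
        -- could precede it.
        · rcases Nat.eq_zero_or_pos i with rfl | hi0
          · have hnil : u' = [] := by
              refine prefix_eq_of_endPt_eq h.1.1 ((List.prefix_append u' _).trans huw)
                (List.nil_prefix) (Prod.ext ?_ ?_)
              · simpa using hu1
              · simpa using hew2
            rw [hnil] at hvu'
            simp at hvu'
          · have := ha.east_extends h3' hzero (by simp; omega) _ hm
            omega
        · have := ha.free _ hm (by omega)
          omega
        · omega
  obtain ⟨u, hu⟩ := key n le_rfl
  have : u = v ++ [.east] := by
    refine prefix_eq_of_endPt_eq h.1.1 ⟨_, hu.symm⟩ hp ?_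
    have hew : endPt u + n • s.vec = (1, 0) := by rw [← he, hu]; simp
    have : endPt v + Dir.east.vec + n • s.vec = (1, 0) := by
      rcases hs with ⟨rfl, e⟩ | ⟨rfl, e⟩ <;> rw [e] <;> simp [Dir.vec]
    rw [endPt_concat]
    exact add_right_cancel (hew.trans this.symm)
  rw [hu, this]

/-- The last step of a polygon is not directed away from or towards the origin. -/
lemma endPt_init_ne {u : Walk} {s : Dir} (h : IsThreeSided (u ++ [s])) (hl : (u ++ [s]).length ≠ 1)
    {d : Dir} (hd : endPt (u ++ [s]) = d.vec) : s.vec ≠ d.vec ∧ s.vec ≠ -d.vec := by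
  obtain ⟨h3, ha⟩ := isThreeSided_concat.1 h
  rw [endPt_concat] at hd
  constructor
  · intro e
    -- The penultimate node would be the origin.
    have : u = [] := prefix_eq_of_endPt_eq h.1.1 (List.prefix_append _ _) (List.nil_prefix)
      (by rw [e] at hd; simpa using hd)
    simp [this] at hl
  · intro e
    -- The last step would start at `2 • d.vec` and point at the origin, two units ahead.
    refine (free_iff u s).1 ha.free _ (zero_mem_vis u) 2 (by omega) ?_
    have : s.vec + d.vec = 0 := by rw [e]; simp
    rw [two_smul, ← add_assoc, hd, add_comm, this]
    rfl

/-- The last step is vertical, and `x = 1` is the east side. Cutting at the first entry into this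
column leaves a coded walk that ends on `x = 0`: either a straight run south from the origin, or a
walk on its top row. -/
lemma classify_east {w : Walk} (h : IsThreeSided w) (hl : w.length ≠ 1)
    (he : endPt w = (1, 0)) :
    (∃ c, Valid c ∧ (∃ w' p t, state c = .top w' p t) ∧ w = closing c) ∨
      ∃ n, 1 ≤ n ∧ w = columnPolygon n := by
  rcases List.eq_nil_or_concat' w with rfl | ⟨u, s, rfl⟩
  · simp [Prod.ext_iff] at he
  obtain ⟨h3, ha⟩ := isThreeSided_concat.1 h
  obtain ⟨n1, n2⟩ := endPt_init_ne h hl (d := .east) he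
  have hsv : s = .south ∨ s = .north := by cases s <;> simp [Dir.vec] at n1 n2 ⊢
  have he' := he
  rw [endPt_concat] at he'
  have he1 := congrArg Prod.fst he'
  have he2 := congrArg Prod.snd he'
  have hzero := zero_mem_vis u
  have hu1 : (endPt u).1 = 1 := by rcases hsv with rfl | rfl <;> simpa [Dir.vec] using he1
  -- For a last step south the final node is examined, for a last step north the penultimate one. It
  -- is not on the north side, nor on the west side because of the origin.
  have hx : ∀ z ∈ Vis u, z.1 ≤ 1 := by
    rcases hsv with rfl | rfl <;> simp [Dir.vec] at he2
    · rcases ha.side with k | k | k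
      · have := k _ (endPt_mem_vis u); simp [Dir.vec] at this
      · intro z hz
        have := k z hz
        simp [Dir.vec] at this
        omega
      · have := k _ hzero
        simp [Dir.vec] at this
        omega
    · rcases h3.onSide with k | k | k
      · have := k _ hzero
        simp only at this
        omega
      · intro z hz
        have := k z hz
        omega
      · have := k _ hzero
        simp only at this
        omega
  have hxw : ∀ z ∈ Vis (u ++ [s]), z.1 ≤ 1 := by
    intro z hz
    rcases mem_vis_concat.1 hz with hz | rfl
    · exact hx z hz
    · rw [he']
  obtain ⟨v, r, rfl, hv, hv0⟩ := exists_first_east (endPt_mem_vis u) hu1.ge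
  have hp : v ++ [.east] <+: v ++ .east :: r ++ [s] := ⟨r ++ [s], by simp⟩
  have hpu : v ++ [.east] <+: v ++ .east :: r := ⟨r, by simp⟩
  have hm := vis_subset_of_prefix hpu (endPt_mem_vis _)
  rw [endPt_concat] at hm
  have m1 : (endPt v + Dir.east.vec).1 = 1 := by simp [hv0, Dir.vec]
  have m2 : (endPt v + Dir.east.vec).2 = (endPt v).2 := by simp [Dir.vec]
  -- Otherwise the column is entered at the endpoint `(1, 0)`, and the walk could not continue.
  have hvne : (endPt v).2 ≠ 0 := by
    intro e
    have : v ++ [.east] = v ++ .east :: r ++ [s] := by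
      refine prefix_eq_of_endPt_eq h.1.1 hp List.prefix_rfl ?_
      rw [he, endPt_concat]
      ext
      · exact m1
      · exact m2.trans e
    have := congrArg List.length this
    simp at this
  have hsign : (s = .south → 0 < (endPt v).2) ∧ (s = .north → (endPt v).2 < 0) := by
    constructor <;> rintro rfl
    · have := ha.free _ hm (by omega)
      simp [Dir.vec, -endPt_append] at he2
      omega
    · have := ha.free _ hm (by omega)
      simp [Dir.vec, -endPt_append] at he2
      omega
  have h3v : IsThreeSided v := h3.of_append
  have hend : ∀ y, (endPt v).2 = y → endPt v = (0, y) := fun y hy => Prod.ext hv0 hy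
  rcases coded_of_isThreeSided h3v hv with
    ⟨c, w, d, t, j, hc, hst, hu⟩ | ⟨c, w, d, t, j, hc, hst, hj, hjd, hu⟩ |
    ⟨c, w, p, t, j, hc, hst, hjp, hu⟩ | ⟨c, w, p, t, j, hc, hst, hj, hjw, hu⟩
  · have I := excInv_word hc hst
    have hfst := I.fst
    have hw : w = 0 := by
      rw [hu] at hv0
      simp [hfst, Dir.vec] at hv0
      exact hv0
    obtain ⟨e, rfl, rfl⟩ := I.start hw
    have hvy : (endPt v).2 = -(j : ℤ) := by simp [hu, e, Dir.vec]
    have hs : s = .north := by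
      rcases hsv with rfl | rfl
      · have := hsign.1 rfl; omega
      · rfl
    refine Or.inr ⟨j, by omega, ?_⟩
    rw [eq_append_run h hxw he hp hv (n := j) (s := .north)
      (Or.inr ⟨rfl, hend _ hvy⟩), hu, e, columnPolygon]
    simp
  · have I := excInv_word hc hst
    have hfst := I.fst
    have hw : w = 0 := by
      rw [hu] at hv0
      simp [hfst, Dir.vec] at hv0
      exact hv0
    have := I.start hw
    omega
  · have I := topInv_word hc hst
    have hfst := I.fst
    have hsnd := I.snd
    have hpos := I.pos
    have hjp : j = p := by
      rw [hu] at hv0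
      simp [hfst, Dir.vec] at hv0
      omega
    subst hjp
    have hvy : (endPt v).2 = t := by simp [hu, hsnd, Dir.vec]
    refine Or.inl ⟨c, hc, ⟨w, j, t, hst⟩, ?_⟩
    rw [eq_append_run h hxw he hp hv (n := t) (s := .south)
      (Or.inl ⟨rfl, hend _ hvy⟩), hu, closing, hst]
    simp [List.replicate_succ']
  · have I := topInv_word hc hst
    have hfst := I.fst
    rw [hu] at hv0
    simp [hfst, Dir.vec] at hv0
    omega

/-- The level of the top row never decreases and is positive after any rise, so only digs can have
occurred. -/
lemma eq_digs_of_state {c : List Sym} (hc : Valid c) {w d : ℕ} (hst : state c = .exc w d 0) :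
    ∃ ds : List ℕ, c = ds.map .dig := by
  induction c generalizing w d with
  | nil => exact ⟨[], rfl⟩
  | cons s c ih =>
    have hs := hc.2
    rw [state] at hst
    cases h : state c with
    | exc w' d' t' =>
      rw [h] at hst hs
      cases s <;> simp only [Allowed] at hs <;> simp only [next, St.exc.injEq, reduceCtorEq] at hst
      obtain ⟨-, -, rfl⟩ := hst
      obtain ⟨ds, rfl⟩ := ih hc.1 h
      exact ⟨_ :: ds, rfl⟩
    | top w' p' t' =>
      have hpos := (topInv_word hc.1 h).pos
      rw [h] at hst hs
      cases s <;> simp only [Allowed] at hs <;> simp only [next, St.exc.injEq, reduceCtorEq] at hst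
      omega

lemma eq_rise_digs_of_state {c : List Sym} (hc : Valid c) {w p : ℕ} (hst : state c = .top w p 1) :
    ∃ ds : List ℕ, c = .rise :: ds.map .dig := by
  cases c with
  | nil => simp [state] at hst
  | cons s c =>
    have hs := hc.2
    rw [state] at hst
    cases h : state c with
    | exc w' d' t' =>
      rw [h] at hst hs
      cases s <;> simp only [Allowed] at hs <;> simp only [next, St.top.injEq, reduceCtorEq] at hst
      obtain rfl : t' = 0 := by omega
      obtain ⟨ds, rfl⟩ := eq_digs_of_state hc.1 h
      exact ⟨ds, rfl⟩
    | top w' p' t' =>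
      have hpos := (topInv_word hc.1 h).pos
      rw [h] at hst hs
      cases s <;> simp only [Allowed] at hs <;> simp only [next, St.top.injEq, reduceCtorEq] at hst
      omega

/-- The last step leads from `(-1, 1)` to `(0, 1)` and does not leave the box, as the origin is in
column `0`. So `y = 1` is the top row; the walk also stays in `x ≤ 0`, hence it is coded and its
code has risen exactly once. -/
lemma classify_north {u : Walk} (h : IsThreeSided (u ++ [.east]))
    (he : endPt (u ++ [.east]) = (0, 1)) : ∃ ds, ds ≠ [] ∧ u ++ [.east] = hanging ds := by
  obtain ⟨h3, ha⟩ := isThreeSided_concat.1 h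
  rw [endPt_concat] at he
  have he1 := congrArg Prod.fst he
  have he2 := congrArg Prod.snd he
  simp [Dir.vec] at he1 he2
  have hzero := zero_mem_vis u
  have hy : ∀ z ∈ Vis u, z.2 ≤ 1 := by
    intro z hz
    by_contra hlt
    have := ha.east_extends h3 hz (by omega) _ hzero
    simp only at this
    omega
  have hx : ∀ z ∈ Vis u, z.1 ≤ 0 := by
    intro z hz
    by_contra hlt
    -- The return to `x ≤ 0` is a step west from some `(1, y)` with `y ≤ 1`. If `y = 1`, that node
    -- blocks the final step east; if `y = 0`, the step hits the origin; if `y < 0`, the step would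
    -- have to leave the box.
    obtain ⟨v, r, rfl, hv⟩ := exists_west_of_leaves hz (by omega) (by omega)
    have hav := h3.adm
    have h3v : IsThreeSided v := h3.of_append
    have hmem : endPt v ∈ Vis (v ++ .west :: r) := vis_subset_append _ _ (endPt_mem_vis v)
    have y1 := hy _ hmem
    have hz0 := zero_mem_vis v
    have y2 : (endPt v).2 ≠ 1 := by
      intro e
      have := ha.free _ hmem (by omega)
      omega
    have y3 : (endPt v).2 ≠ 0 := by
      intro e
      refine hav.endPt_notMem ?_
      convert hz0 using 1
      ext
      · simp [hv, Dir.vec]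
      · simp [e, Dir.vec]
    have := hav.west_extends h3v hz0 (by simp only; omega) _ hz0
    simp only at this
    omega
  rcases coded_of_isThreeSided h3 hx with
    ⟨c, w, d, t, j, hc, hst, hu⟩ | ⟨c, w, d, t, j, hc, hst, hj, hjd, hu⟩ |
    ⟨c, w, p, t, j, hc, hst, hjp, hu⟩ | ⟨c, w, p, t, j, hc, hst, hj, hjw, hu⟩
  · have I := excInv_word hc hst
    have hsub : Vis (word c) ⊆ Vis u := hu ▸ vis_subset_append _ _
    have k1 : (endPt u).1 = -w := by simp [hu, I.fst, Dir.vec]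
    have k2 : (endPt u).2 = t - d - j := by simp [hu, I.snd, Dir.vec]; ring
    -- The end would be on the top row, with a visited node further east in that row.
    obtain ⟨z, hz, z1, z2⟩ := I.top (by omega)
    have := hy z (hsub hz)
    have := ha.free z (hsub hz) (by omega)
    omega
  · have I := excInv_word hc hst
    have hsub : Vis (word c) ⊆ Vis u := hu ▸ vis_subset_append _ _
    have k1 : (endPt u).1 = -w := by simp [hu, I.fst, Dir.vec]
    have k2 : (endPt u).2 = t - d + j := by simp [hu, I.snd, Dir.vec]
    obtain ⟨z, hz, z1, z2⟩ := I.top (by omega)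
    have := hy z (hsub hz)
    have := ha.free z (hsub hz) (by omega)
    omega
  · have I := topInv_word hc hst
    have k1 : (endPt u).1 = -p + j := by simp [hu, I.fst, Dir.vec]
    have k2 : (endPt u).2 = t := by simp [hu, I.snd, Dir.vec]
    obtain rfl : t = 1 := by omega
    obtain ⟨ds, rfl⟩ := eq_rise_digs_of_state hc hst
    rw [state_rise_digs] at hst
    simp only [St.top.injEq] at hst
    have hlen : ds.length = j + 1 := by omega
    refine ⟨ds, ?_, ?_⟩
    · rintro rfl
      simp at hlen
    · rw [hanging, hlen, hu, List.replicate_succ', List.append_assoc]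
  · have I := topInv_word hc hst
    have hsub : Vis (word c) ⊆ Vis u := hu ▸ vis_subset_append _ _
    have k1 : (endPt u).1 = -p - j := by simp [hu, I.fst, Dir.vec]; ring
    have k2 : (endPt u).2 = t := by simp [hu, I.snd, Dir.vec]
    have := ha.free _ (hsub (endPt_mem_vis _)) (by rw [I.snd, k2])
    have := I.fst
    omega

/-- One half of the 3-sided prudent polygons; the other half is obtained by reflection. -/
inductive IsBasic (w : Walk) : Prop
  | closing (c : List Sym) (hc : Valid c) (w' p t : ℕ) (hst : state c = .top w' p t)
      (h : w = closing c)
  | column (n : ℕ) (hn : 1 ≤ n) (h : w = columnPolygon n)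
  | hanging (ds : List ℕ) (hds : ds ≠ []) (h : w = hanging ds)

lemma isBasic_of_east {w : Walk} (h : IsThreeSided w) (hl : w.length ≠ 1)
    (he : endPt w = (1, 0)) : IsBasic w := by
  rcases classify_east h hl he with ⟨c, hc, ⟨w', p, t, hst⟩, e⟩ | ⟨n, hn, e⟩
  · exact .closing c hc w' p t hst e
  · exact .column n hn e

/-- An end at `(0, -1)` is impossible: the last step is horizontal, below the origin and towards its
column, so it does not leave the box. -/
lemma isBasic_or_mirror {n : ℕ} {w : Walk} (h : w ∈ threeSidedPolygons n) :
    IsBasic w ∨ IsBasic w.mirror := by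
  obtain ⟨⟨-, hl, d, hd⟩, h3, -⟩ := h
  rw [pos_length] at hd
  cases d with
  | east => exact Or.inl (isBasic_of_east h3 hl hd)
  | west =>
    refine Or.inr (isBasic_of_east h3.mirror (by simpa using hl) ?_)
    rw [endPt_mirror, hd]
    simp [Dir.vec]
  | north =>
    rcases List.eq_nil_or_concat' w with rfl | ⟨u, s, rfl⟩
    · simp [Dir.vec, Prod.ext_iff] at hd
    have hne := endPt_init_ne h3 hl hd
    cases s with
    | north => simp at hne
    | south => simp [Dir.vec] at hne
    | east =>
      obtain ⟨ds, hds, e⟩ := classify_north h3 hd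
      exact Or.inl (.hanging ds hds e)
    | west =>
      have h3' := h3.mirror
      have hd' := endPt_mirror (u ++ [.west])
      rw [hd] at hd'
      rw [mirror_concat] at h3' hd' ⊢
      obtain ⟨ds, hds, e⟩ := classify_north h3' hd'
      exact Or.inr (.hanging ds hds e)
  | south =>
    exfalso
    rcases List.eq_nil_or_concat' w with rfl | ⟨u, s, rfl⟩
    · simp [Dir.vec, Prod.ext_iff] at hd
    have hne := endPt_init_ne h3 hl hd
    obtain ⟨h3', ha⟩ := isThreeSided_concat.1 h3
    rw [endPt_concat] at hd
    have he1 := congrArg Prod.fst hd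
    have he2 := congrArg Prod.snd hd
    have hzero := zero_mem_vis u
    cases s with
    | south => simp at hne
    | north => simp [Dir.vec] at hne
    | east =>
      simp [Dir.vec] at he1 he2
      have := ha.east_extends h3' hzero (by simp only; omega) _ hzero
      simp only at this
      omega
    | west =>
      simp [Dir.vec] at he1 he2
      have := ha.west_extends h3' hzero (by simp only; omega) _ hzero
      simp only at this
      omega

end Prudent

namespace Prudent
open Walk

/-! ### Counting codes -/

lemma encard_biUnion_finset {ι α : Type*} (s : Finset ι) (S : ι → Set α) (g : ι → ℕ)
    (h : ∀ i ∈ s, (S i).encard = g i)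
    (hd : ∀ i ∈ s, ∀ j ∈ s, i ≠ j → Disjoint (S i) (S j)) :
    (⋃ i ∈ s, S i).encard = (∑ i ∈ s, g i : ℕ) := by
  classical
  induction s using Finset.induction_on with
  | empty => simp
  | insert a s ha ih =>
    rw [Finset.set_biUnion_insert, Set.encard_union_eq, Finset.sum_insert ha, Nat.cast_add,
      h a (Finset.mem_insert_self a s),
      ih (fun i hi => h i (Finset.mem_insert_of_mem hi))
        fun i hi j hj => hd i (Finset.mem_insert_of_mem hi) j (Finset.mem_insert_of_mem hj)]
    rw [Set.disjoint_iUnion₂_right]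
    exact fun i hi => hd a (Finset.mem_insert_self a s) i (Finset.mem_insert_of_mem hi)
      fun e => ha (e ▸ hi)

/-- The codes of weight `a` that lead to a state `exc w _ _`. -/
def excCodes (w a : ℕ) : Set (List Sym) :=
  {c | Valid c ∧ (∃ d t, state c = .exc w d t) ∧ weight c = a}

/-- The codes of weight `a` that lead to a state `top w _ _`. -/
def topCodes (w a : ℕ) : Set (List Sym) :=
  {c | Valid c ∧ (∃ p t, state c = .top w p t) ∧ weight c = a}

lemma encard_cons_image (s : Sym) (S : Set (List Sym)) :
    ((fun c => s :: c) '' S).encard = S.encard :=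
  (List.cons_injective (a := s)).injOn.encard_image

lemma excCodes_zero_left (a : ℕ) : excCodes 0 a = {c | c = [] ∧ a = 0} := by
  ext c
  constructor
  · rintro ⟨hc, ⟨d, t, hst⟩, rfl⟩
    cases c with
    | nil => exact ⟨rfl, rfl⟩
    | cons s c =>
      have hs := hc.2
      rw [state] at hst
      cases h : state c <;> rw [h] at hst hs <;> cases s <;> simp [next] at hst <;>
        simp [Allowed] at hs
  · rintro ⟨rfl, rfl⟩
    exact ⟨trivial, ⟨0, 0, rfl⟩, rfl⟩

lemma excCodes_succ_left (w a : ℕ) : excCodes (w + 1) a =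
    (fun c => .ext :: c) '' topCodes w a ∪
      ⋃ d ∈ Finset.range (a + 1), (fun c => .dig d :: c) '' excCodes w (a - d) := by
  ext c
  simp only [Set.mem_union, Set.mem_iUnion, Set.mem_image, Finset.mem_range]
  constructor
  · rintro ⟨hc, ⟨d, t, hst⟩, rfl⟩
    cases c with
    | nil => simp [state] at hst
    | cons s c =>
      have hs := hc.2
      rw [state] at hst
      rw [weight]
      cases h : state c <;> rw [h] at hst hs <;> cases s <;> simp only [Allowed] at hs <;>
        simp only [next, St.exc.injEq, reduceCtorEq] at hst
      · obtain ⟨h1, rfl, rfl⟩ := hst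
        obtain rfl := Nat.add_right_cancel h1
        exact Or.inr ⟨_, by simp [letterWeight], c,
          ⟨hc.1, ⟨_, _, h⟩, by simp [letterWeight]⟩, rfl⟩
      · obtain ⟨h1, rfl, rfl⟩ := hst
        obtain rfl := Nat.add_right_cancel h1
        exact Or.inl ⟨c, ⟨hc.1, ⟨_, _, h⟩, by simp [letterWeight]⟩, rfl⟩
  · rintro (⟨c, ⟨hc, ⟨p, t, h⟩, rfl⟩, rfl⟩ | ⟨d, hd, c, ⟨hc, ⟨d', t, h⟩, e⟩, rfl⟩)
    · exact ⟨⟨hc, by rw [h]; trivial⟩, ⟨0, t, by rw [state, h]; rfl⟩, by rw [weight, h]; rfl⟩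
    · exact ⟨⟨hc, by rw [h]; trivial⟩, ⟨d, t, by rw [state, h]; rfl⟩, by
        rw [weight, h, e, letterWeight]; omega⟩

/-- Codes are sorted by their last letter. The inequalities guard against truncated subtraction. -/
lemma topCodes_eq (w a : ℕ) : topCodes w a =
    (fun c => .rise :: c) '' {c | c ∈ excCodes w (a - (w + 1)) ∧ w + 1 ≤ a} ∪
      ⋃ p ∈ Finset.range (w + 1), (fun c => .row p :: c) ''
        {c | c ∈ topCodes w (a - (p + 1)) ∧ p + 1 ≤ a} := by
  ext c
  simp only [Set.mem_union, Set.mem_iUnion, Set.mem_image, Finset.mem_range]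
  constructor
  · rintro ⟨hc, ⟨p, t, hst⟩, rfl⟩
    cases c with
    | nil => simp [state] at hst
    | cons s c =>
      have hs := hc.2
      rw [state] at hst
      rw [weight]
      cases h : state c <;> rw [h] at hst hs <;> cases s <;> simp only [Allowed] at hs <;>
        simp only [next, St.top.injEq, reduceCtorEq] at hst
      · obtain ⟨rfl, rfl, rfl⟩ := hst
        exact Or.inl ⟨c, ⟨⟨hc.1, ⟨_, _, h⟩, by simp [letterWeight]⟩, by simp [letterWeight]⟩, rfl⟩
      · obtain ⟨rfl, rfl, rfl⟩ := hst
        exact Or.inr ⟨_, by omega, c,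
          ⟨⟨hc.1, ⟨_, _, h⟩, by simp [letterWeight]⟩, by simp [letterWeight]⟩, rfl⟩
  · rintro (⟨c, ⟨⟨hc, ⟨d, t, h⟩, e⟩, hle⟩, rfl⟩ | ⟨p, hp, c, ⟨⟨hc, ⟨p', t, h⟩, e⟩, hle⟩, rfl⟩)
    · exact ⟨⟨hc, by rw [h]; trivial⟩, ⟨w, t + 1, by rw [state, h]; rfl⟩, by
        rw [weight, h, e, letterWeight]; omega⟩
    · exact ⟨⟨hc, by rw [h, Allowed]; omega⟩, ⟨p, t + 1, by rw [state, h]; rfl⟩, by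
        rw [weight, h, e, letterWeight]; omega⟩

/-- The numbers of codes, by a recursion of bounded depth: `codeCount k true w a` counts
`topCodes w a` and `codeCount k false w a` counts `excCodes w a` if `k` is large. -/
def codeCount : ℕ → Bool → ℕ → ℕ → ℕ
  | 0, _, _, _ => 0
  | _ + 1, false, 0, a => if a = 0 then 1 else 0
  | k + 1, false, w + 1, a =>
    codeCount k true w a + ∑ d ∈ Finset.range (a + 1), codeCount k false w (a - d)
  | k + 1, true, w, a =>
    (if w + 1 ≤ a then codeCount k false w (a - (w + 1)) else 0) +
      ∑ p ∈ Finset.range (w + 1), if p + 1 ≤ a then codeCount k true w (a - (p + 1)) else 0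

lemma disjoint_cons_image {s s' : Sym} (h : s ≠ s') (S T : Set (List Sym)) :
    Disjoint ((fun c => s :: c) '' S) ((fun c => s' :: c) '' T) := by
  rw [Set.disjoint_left]
  rintro _ ⟨c, -, rfl⟩ ⟨c', -, e⟩
  simp only [List.cons.injEq] at e
  exact h e.1.symm

lemma encard_sep_const {α : Type*} {S : Set α} {P : Prop} [Decidable P] {n : ℕ}
    (h : P → S.encard = n) : {c | c ∈ S ∧ P}.encard = ((if P then n else 0 : ℕ) : ℕ∞) := by
  by_cases hP : P
  · simp [hP, h hP]
  · simp [hP]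

/-- The measure `2 * w + a`, plus one for `top`, drops whenever the last letter is removed, so any
depth above it suffices. -/
lemma encard_codes (k : ℕ) :
    (∀ w a, 2 * w + a < k → (excCodes w a).encard = codeCount k false w a) ∧
      ∀ w a, 2 * w + a + 1 < k → (topCodes w a).encard = codeCount k true w a := by
  induction k with
  | zero => exact ⟨fun _ _ h => by omega, fun _ _ h => by omega⟩
  | succ k ih =>
    obtain ⟨ih1, ih2⟩ := ih
    constructor
    · intro w a hk
      cases w with
      | zero =>
        rw [excCodes_zero_left, codeCount]
        by_cases ha : a = 0 <;> simp [ha]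
      | succ w =>
        rw [excCodes_succ_left, codeCount, Set.encard_union_eq, encard_cons_image,
          ih2 w a (by omega), encard_biUnion_finset _ _ (fun d => codeCount k false w (a - d)),
          Nat.cast_add]
        · intro d _
          rw [encard_cons_image]
          exact ih1 _ _ (by omega)
        · intro d _ d' _ hne
          exact disjoint_cons_image (by simpa using hne) _ _
        · rw [Set.disjoint_iUnion₂_right]
          exact fun d _ => disjoint_cons_image (by simp) _ _
    · intro w a hk
      rw [topCodes_eq, codeCount, Set.encard_union_eq, encard_cons_image,
        encard_sep_const (fun h => ih1 w (a - (w + 1)) (by omega)),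
        encard_biUnion_finset _ _
          (fun p => if p + 1 ≤ a then codeCount k true w (a - (p + 1)) else 0), Nat.cast_add]
      · intro p _
        rw [encard_cons_image]
        exact encard_sep_const fun h => ih2 _ _ (by omega)
      · intro p _ p' _ hne
        exact disjoint_cons_image (by simpa using hne) _ _
      · rw [Set.disjoint_iUnion₂_right]
        exact fun p _ => disjoint_cons_image (by simp) _ _

/-- The number of codes in `excCodes w a`. -/
def excCount (w a : ℕ) : ℕ := codeCount (2 * w + a + 1) false w a

/-- The number of codes in `topCodes w a`. -/
def topCount (w a : ℕ) : ℕ := codeCount (2 * w + a + 2) true w a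

lemma encard_excCodes (w a : ℕ) : (excCodes w a).encard = excCount w a :=
  (encard_codes _).1 w a (by omega)

lemma encard_topCodes (w a : ℕ) : (topCodes w a).encard = topCount w a :=
  (encard_codes _).2 w a (by omega)

/-- Any sufficient depth counts the same set, so the value does not depend on it. -/
lemma codeCount_false {k w a : ℕ} (h : 2 * w + a < k) : codeCount k false w a = excCount w a := by
  have := (encard_codes k).1 w a h
  rw [encard_excCodes] at this
  exact_mod_cast this.symm

lemma codeCount_true {k w a : ℕ} (h : 2 * w + a + 1 < k) :
    codeCount k true w a = topCount w a := by
  have := (encard_codes k).2 w a h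
  rw [encard_topCodes] at this
  exact_mod_cast this.symm

lemma excCount_zero_left (a : ℕ) : excCount 0 a = if a = 0 then 1 else 0 := by
  rw [excCount, codeCount]

lemma excCount_succ_left (w a : ℕ) :
    excCount (w + 1) a = topCount w a + ∑ d ∈ Finset.range (a + 1), excCount w (a - d) := by
  rw [excCount, codeCount, codeCount_true (by omega)]
  congr 1
  exact Finset.sum_congr rfl fun d _ => codeCount_false (by omega)

lemma topCount_eq (w a : ℕ) :
    topCount w a = (if w + 1 ≤ a then excCount w (a - (w + 1)) else 0) +
      ∑ p ∈ Finset.range (w + 1), if p + 1 ≤ a then topCount w (a - (p + 1)) else 0 := by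
  rw [topCount, codeCount]
  congr 1
  · split_ifs
    · exact codeCount_false (by omega)
    · rfl
  · refine Finset.sum_congr rfl fun p _ => ?_
    split_ifs
    · exact codeCount_true (by omega)
    · rfl

/-- The last rise alone weighs `w + 1`, and later rows keep `w`. Thus the area bounds the width, and
all sums over `w` are finite. -/
lemma lt_weight {c : List Sym} (hc : Valid c) {w p t : ℕ} (hst : state c = .top w p t) :
    w < weight c := by
  induction c generalizing w p t with
  | nil => simp [state] at hst
  | cons s c ih =>
    have hs := hc.2
    rw [state] at hst
    rw [weight]
    cases h : state c <;> rw [h] at hst hs <;> cases s <;> simp only [Allowed] at hs <;>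
      simp only [next, St.top.injEq, reduceCtorEq] at hst
    · simp only [letterWeight]; omega
    · have := ih hc.1 h
      simp only [letterWeight]; omega

lemma topCodes_eq_empty {w a : ℕ} (h : a ≤ w) : topCodes w a = ∅ := by
  ext c
  simp only [Set.mem_empty_iff_false, iff_false]
  rintro ⟨hc, ⟨p, t, hst⟩, rfl⟩
  exact absurd (lt_weight hc hst) (by omega)

lemma topCount_eq_zero {w a : ℕ} (h : a ≤ w) : topCount w a = 0 := by
  have := encard_topCodes w a
  rw [topCodes_eq_empty h] at this
  simpa using this.symm

/-! ### Counting polygons -/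

/-- The walk of a code that leads to the top row ends with a step to the north. -/
lemma exists_word_eq_concat {c : List Sym} (hc : Valid c) {w p t : ℕ}
    (hst : state c = .top w p t) : ∃ v, word c = v ++ [.north] := by
  cases c with
  | nil => simp [state] at hst
  | cons s c =>
    have hs := hc.2
    rw [state] at hst
    rw [word]
    cases h : state c <;> rw [h] at hst hs <;> cases s <;> simp only [Allowed] at hs <;>
      simp only [next, St.top.injEq, reduceCtorEq] at hst
    · rename_i d _
      exact ⟨word c ++ List.replicate d .north, by simp [block, List.replicate_succ']⟩
    · exact ⟨_, (List.append_assoc _ _ _).symm⟩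

lemma append_run_inj {v v' : Walk} {k k' : ℕ} {x y : Dir} (h : y ≠ x)
    (e : v ++ [y] ++ List.replicate k x = v' ++ [y] ++ List.replicate k' x) :
    k = k' ∧ v = v' := by
  have e' := congrArg List.reverse e
  simp only [List.reverse_append, List.reverse_replicate, List.reverse_singleton,
    List.singleton_append] at e'
  obtain ⟨h1, -, h3⟩ := replicate_append_cons_inj h h e'
  exact ⟨h1, List.reverse_injective h3⟩

lemma closing_eq {c : List Sym} {w p t : ℕ} (hst : state c = .top w p t) :
    closing c = word c ++ List.replicate p .east ++ [.east] ++ List.replicate t .south := by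
  simp [closing, hst, List.replicate_succ']

/-- Read from the end, the runs south and east can be stripped off: the walk of the code ends with a
step north. -/
lemma closing_injOn : Set.InjOn closing {c | Valid c ∧ ∃ w p t, state c = .top w p t} := by
  rintro c ⟨hc, w, p, t, hst⟩ c' ⟨hc', w', p', t', hst'⟩ e
  rw [closing_eq hst, closing_eq hst'] at e
  obtain ⟨-, e⟩ := append_run_inj (by simp) e
  obtain ⟨v, hv⟩ := exists_word_eq_concat hc hst
  obtain ⟨v', hv'⟩ := exists_word_eq_concat hc' hst'
  rw [hv, hv'] at e
  obtain ⟨-, e⟩ := append_run_inj (by simp) e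
  exact word_injOn hc hc' (by rw [hv, hv', e])

lemma hanging_injective : Function.Injective hanging := by
  intro ds ds' e
  obtain ⟨v, hv⟩ := exists_word_eq_concat (valid_rise_digs ds) (state_rise_digs ds)
  obtain ⟨v', hv'⟩ := exists_word_eq_concat (valid_rise_digs ds') (state_rise_digs ds')
  rw [hanging, hanging, hv, hv'] at e
  obtain ⟨-, e⟩ := append_run_inj (by simp) e
  have hw : word (.rise :: ds.map .dig) = word (.rise :: ds'.map .dig) := by rw [hv, hv', e]
  have := word_injOn (valid_rise_digs ds) (valid_rise_digs ds') hw
  simp only [List.cons.injEq, true_and] at this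
  exact List.map_injective_iff.2 (fun a b h => by simpa using h) this

/-- The lists of naturals with given sum of the `d + 1`. -/
def digLists (n : ℕ) : Set (List ℕ) := {ds | ds.sum + ds.length = n}

lemma digLists_succ (n : ℕ) : digLists (n + 1) =
    ⋃ d ∈ Finset.range (n + 1), (fun l => d :: l) '' digLists (n - d) := by
  ext ds
  simp only [digLists, Set.mem_iUnion, Set.mem_image, Finset.mem_range, Set.mem_ofPred_eq]
  constructor
  · intro h
    cases ds with
    | nil => simp at h
    | cons d l =>
      simp only [List.sum_cons, List.length_cons] at h
      exact ⟨d, by omega, l, by omega, rfl⟩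
  · rintro ⟨d, hd, l, hl, rfl⟩
    simp only [List.sum_cons, List.length_cons]
    omega

/-- These are the compositions of `n + 1` with parts `d + 1`. Sorting by the first part gives `1 +
(1 + 2 + ⋯ + 2 ^ (n - 1))`, the isolated `1` coming from the empty rest. -/
lemma encard_digLists_succ (n : ℕ) : (digLists (n + 1)).encard = (2 ^ n : ℕ) := by
  have h0 : (digLists 0).encard = (1 : ℕ) := by
    have : digLists 0 = {[]} := by
      ext ds
      cases ds <;> simp [digLists]
    rw [this]
    simp
  induction n using Nat.strong_induction_on with
  | _ n ih =>
    have hg : ∀ m ≤ n, (digLists m).encard = ((if m = 0 then 1 else 2 ^ (m - 1) : ℕ) : ℕ∞) := by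
      intro m hm
      cases m with
      | zero => simpa using h0
      | succ m => simpa using ih m (by omega)
    rw [digLists_succ, encard_biUnion_finset _ _
      (fun d => if n - d = 0 then 1 else 2 ^ (n - d - 1))]
    · congr 1
      have h1 := Finset.sum_range_reflect (fun m => if m = 0 then 1 else 2 ^ (m - 1)) (n + 1)
      simp only [Nat.add_sub_cancel] at h1
      rw [h1, Finset.sum_range_succ']
      have h2 := Nat.geomSum_eq (m := 2) le_rfl n
      simp at h2 ⊢
      have := Nat.one_le_two_pow (n := n)
      omega
    · intro d _
      rw [(List.cons_injective (a := d)).injOn.encard_image]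
      exact hg _ (by omega)
    · intro d _ d' _ hne
      rw [Set.disjoint_left]
      rintro _ ⟨c, -, rfl⟩ ⟨c', -, e⟩
      simp only [List.cons.injEq] at e
      exact hne e.1.symm

/-- The polygons of area `n` in the first half. -/
def basicPolygons (n : ℕ) : Set Walk := {w | IsBasic w ∧ w ∈ threeSidedPolygons n}

lemma area_unique {w : Walk} {m n : ℕ} (h : w ∈ threeSidedPolygons m)
    (h' : w ∈ threeSidedPolygons n) : m = n := h.2.2.symm.trans h'.2.2

lemma basicPolygons_succ (n : ℕ) : basicPolygons (n + 1) =
    closing '' (⋃ w ∈ Finset.range (n + 1), topCodes w (n + 1)) ∪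
      ({columnPolygon (n + 1)} ∪ hanging '' digLists (n + 1)) := by
  ext u
  constructor
  · rintro ⟨hb, hu⟩
    rcases hb with ⟨c, hc, w, p, t, hst, rfl⟩ | ⟨m, hm, rfl⟩ | ⟨ds, hds, rfl⟩
    · left
      have hw := area_unique (closing_mem hc hst) hu
      refine ⟨c, ?_, rfl⟩
      simp only [Set.mem_iUnion, Finset.mem_range]
      exact ⟨w, hw ▸ lt_weight hc hst, hc, ⟨p, t, hst⟩, hw⟩
    · right; left
      rw [area_unique (columnPolygon_mem hm) hu]
      rfl
    · right; right
      exact ⟨ds, area_unique (hanging_mem hds) hu, rfl⟩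
  · rintro (⟨c, hc, rfl⟩ | rfl | ⟨ds, hds, rfl⟩)
    · simp only [Set.mem_iUnion] at hc
      obtain ⟨w, -, hc, ⟨p, t, hst⟩, hw⟩ := hc
      exact ⟨.closing c hc w p t hst rfl, hw ▸ closing_mem hc hst⟩
    · exact ⟨.column _ (by omega) rfl, columnPolygon_mem (by omega)⟩
    · have hne : ds ≠ [] := by
        rintro rfl
        simp [digLists] at hds
      exact ⟨.hanging ds hne rfl, hds ▸ hanging_mem hne⟩

/-- The last step tells the three families apart: south, north and east respectively. -/
lemma getLast?_closing {c : List Sym} (hc : Valid c) {w p t : ℕ} (hst : state c = .top w p t) :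
    (closing c).getLast? = some .south := by
  have := (topInv_word hc hst).pos
  obtain ⟨m, rfl⟩ : ∃ m, t = m + 1 := ⟨t - 1, by omega⟩
  rw [closing_eq hst, List.replicate_succ', ← List.append_assoc,
    List.getLast?_concat]

lemma getLast?_columnPolygon {n : ℕ} (hn : 1 ≤ n) :
    (columnPolygon n).getLast? = some .north := by
  obtain ⟨m, rfl⟩ : ∃ m, n = m + 1 := ⟨n - 1, by omega⟩
  rw [columnPolygon, List.replicate_succ' (n := m) (a := Dir.north), ← List.append_assoc,
    List.getLast?_concat]

lemma getLast?_hanging {ds : List ℕ} (h : ds ≠ []) : (hanging ds).getLast? = some .east := by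
  obtain ⟨m, hm⟩ : ∃ m, ds.length = m + 1 :=
    ⟨ds.length - 1, by have := List.length_pos_iff.2 h; omega⟩
  rw [hanging, hm, List.replicate_succ', ← List.append_assoc,
    List.getLast?_concat]

lemma encard_basicPolygons_succ (n : ℕ) : (basicPolygons (n + 1)).encard =
    ((∑ w ∈ Finset.range (n + 1), topCount w (n + 1) + (1 + 2 ^ n) : ℕ) : ℕ∞) := by
  have hne : ∀ ds ∈ digLists (n + 1), ds ≠ [] := by
    rintro ds hds rfl
    simp [digLists] at hds
  rw [basicPolygons_succ, Set.encard_union_eq, Set.encard_union_eq, Set.InjOn.encard_image,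
    hanging_injective.injOn.encard_image, encard_digLists_succ, Set.encard_singleton,
    encard_biUnion_finset _ _ (fun w => topCount w (n + 1))]
  · push_cast; rfl
  · exact fun w _ => encard_topCodes w (n + 1)
  · intro w _ w' _ hww
    rw [Set.disjoint_left]
    rintro c ⟨-, ⟨p, t, h⟩, -⟩ ⟨-, ⟨p', t', h'⟩, -⟩
    rw [h] at h'
    simp only [St.top.injEq] at h'
    exact hww h'.1
  · refine closing_injOn.mono ?_
    intro c hc
    simp only [Set.mem_iUnion] at hc
    obtain ⟨w, -, hc, ⟨p, t, hst⟩, -⟩ := hc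
    exact ⟨hc, w, p, t, hst⟩
  · rw [Set.disjoint_singleton_left]
    rintro ⟨ds, hds, e⟩
    have := getLast?_hanging (hne ds hds)
    rw [e, getLast?_columnPolygon (by omega)] at this
    simp at this
  · rw [Set.disjoint_left]
    rintro _ ⟨c, hc, rfl⟩ h
    simp only [Set.mem_iUnion] at hc
    obtain ⟨w, -, hc, ⟨p, t, hst⟩, -⟩ := hc
    have hl := getLast?_closing hc hst
    rcases h with h | ⟨ds, hds, e⟩
    · rw [h, getLast?_columnPolygon (by omega)] at hl
      simp at hl
    · rw [← e, getLast?_hanging (hne ds hds)] at hl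
      simp at hl

lemma IsBasic.endPt_or {w : Walk} (h : IsBasic w) :
    endPt w = (1, 0) ∨ endPt w = (0, 1) ∧ w.getLast? = some .east := by
  rcases h with ⟨c, hc, w', p, t, hst, rfl⟩ | ⟨m, hm, rfl⟩ | ⟨ds, hds, rfl⟩
  · exact Or.inl (endPt_closing hc hst)
  · exact Or.inl (endPt_columnPolygon m)
  · exact Or.inr ⟨endPt_hanging ds, getLast?_hanging hds⟩

/-- Reflection moves the end `(1, 0)` to `(-1, 0)`; it keeps the end `(0, 1)` but turns the last
step from east to west. -/
lemma IsBasic.not_mirror {w : Walk} (h : IsBasic w) : ¬ IsBasic w.mirror := by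
  intro h'
  have e := endPt_mirror w
  rcases h.endPt_or with h1 | ⟨h1, h2⟩ <;> rcases h'.endPt_or with k1 | ⟨k1, k2⟩ <;>
    rw [h1, k1] at e <;> simp at e
  simp [Walk.mirror, h2, Dir.mirror] at k2

lemma threeSidedPolygons_eq (n : ℕ) :
    threeSidedPolygons n = basicPolygons n ∪ Walk.mirror '' basicPolygons n := by
  ext w
  constructor
  · intro h
    rcases isBasic_or_mirror h with hb | hb
    · exact Or.inl ⟨hb, h⟩
    · exact Or.inr ⟨w.mirror, ⟨hb, mirror_mem h⟩, mirror_mirror w⟩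
  · rintro (h | ⟨u, h, rfl⟩)
    · exact h.2
    · exact mirror_mem h.2

lemma encard_threeSidedPolygons (n : ℕ) :
    (threeSidedPolygons n).encard = (basicPolygons n).encard + (basicPolygons n).encard := by
  rw [threeSidedPolygons_eq, Set.encard_union_eq, mirror_injective.injOn.encard_image]
  rw [Set.disjoint_left]
  rintro _ h ⟨u, h', rfl⟩
  exact h'.1.not_mirror h.1

lemma threeSidedPolygons_zero : threeSidedPolygons 0 = ∅ := by
  have : basicPolygons 0 = ∅ := by
    ext u
    simp only [Set.mem_empty_iff_false, iff_false]
    rintro ⟨hb, hu⟩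
    rcases hb with ⟨c, hc, w, p, t, hst, rfl⟩ | ⟨m, hm, rfl⟩ | ⟨ds, hds, rfl⟩
    · have := lt_weight hc hst
      have := area_unique (closing_mem hc hst) hu
      omega
    · have := area_unique (columnPolygon_mem hm) hu
      omega
    · have := area_unique (hanging_mem hds) hu
      have := List.length_pos_iff.2 hds
      omega
  rw [threeSidedPolygons_eq, this]
  simp

/-- The number of 3-sided prudent polygons of area `n + 1`. -/
lemma encard_threeSidedPolygons_succ (n : ℕ) : (threeSidedPolygons (n + 1)).encard =
    ((2 * (∑ w ∈ Finset.range (n + 1), topCount w (n + 1) + (1 + 2 ^ n)) : ℕ) : ℕ∞) := by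
  rw [encard_threeSidedPolygons, encard_basicPolygons_succ, two_mul]
  push_cast
  rfl

theorem finite_threeSidedPolygons (n : ℕ) : (threeSidedPolygons n).Finite := by
  cases n with
  | zero => simp [threeSidedPolygons_zero]
  | succ n => exact Set.finite_of_encard_eq_coe (encard_threeSidedPolygons_succ n)

lemma ncard_threeSidedPolygons_succ (n : ℕ) : (threeSidedPolygons (n + 1)).ncard =
    2 * (∑ w ∈ Finset.range (n + 1), topCount w (n + 1) + (1 + 2 ^ n)) := by
  rw [Set.ncard, encard_threeSidedPolygons_succ, ENat.toNat_natCast]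

lemma ncard_threeSidedPolygons_values (n : ℕ) (hn : n < 11) : (threeSidedPolygons n).ncard =
    [0, 6, 10, 20, 42, 92, 204, 454, 1010, 2242, 4962].getD n 0 := by
  cases n with
  | zero => simp [threeSidedPolygons_zero]
  | succ n =>
    rw [ncard_threeSidedPolygons_succ]
    -- `codeCount` recurses structurally on its depth, so these sums can be evaluated.
    have h : ∀ n < 10, 2 * (∑ w ∈ Finset.range (n + 1), topCount w (n + 1) + (1 + 2 ^ n)) =
        [0, 6, 10, 20, 42, 92, 204, 454, 1010, 2242, 4962].getD (n + 1) 0 := by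
      decide +kernel
    exact h n (by omega)

end Prudent

namespace Prudent
open PowerSeries

/-! ### Generating functions -/

/-- The generating function of `excCodes w`. -/
noncomputable def excSeries (w : ℕ) : PowerSeries ℚ := PowerSeries.mk fun a => (excCount w a : ℚ)

/-- The generating function of `topCodes w`. -/
noncomputable def topSeries (w : ℕ) : PowerSeries ℚ := PowerSeries.mk fun a => (topCount w a : ℚ)

lemma excSeries_zero : excSeries 0 = 1 := by
  ext a
  rw [excSeries, coeff_mk, excCount_zero_left, coeff_one]
  split_ifs <;> simp

/-- A final dig of arbitrary depth contributes the factor `1 / (1 - X)`, and a final `ext` weighs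
nothing. -/
lemma excSeries_succ (w : ℕ) :
    (1 - X) * excSeries (w + 1) = (1 - X) * topSeries w + excSeries w := by
  have h : excSeries (w + 1) = topSeries w + PowerSeries.mk 1 * excSeries w := by
    ext a
    rw [map_add, coeff_mul, Finset.Nat.sum_antidiagonal_eq_sum_range_succ_mk]
    simp [excSeries, topSeries, excCount_succ_left]
  have h1 := PowerSeries.mk_one_mul_one_sub_eq_one ℚ
  rw [h]
  linear_combination excSeries w * h1

/-- A final row contributes `X + ⋯ + X ^ (w + 1)`; multiplication by `1 - X` sums this geometric
progression. -/
lemma topSeries_eq (w : ℕ) : (1 - 2 * X + X ^ (w + 2)) * topSeries w =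
    (1 - X) * X ^ (w + 1) * excSeries w := by
  have h : topSeries w = X ^ (w + 1) * excSeries w +
      ∑ p ∈ Finset.range (w + 1), X ^ (p + 1) * topSeries w := by
    ext a
    rw [map_add, map_sum, topSeries, coeff_mk, topCount_eq]
    simp only [coeff_X_pow_mul', excSeries, coeff_mk]
    push_cast
    rfl
  rw [← Finset.sum_mul] at h
  have hg : (∑ p ∈ Finset.range (w + 1), (X : PowerSeries ℚ) ^ (p + 1)) * (1 - X) =
      X - X ^ (w + 2) := by
    have := geom_sum_mul_neg (X : PowerSeries ℚ) (w + 1)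
    simp only [pow_succ _ (_ : ℕ), ← Finset.sum_mul] at this ⊢
    linear_combination X * this
  linear_combination (1 - X) * h + topSeries w * hg

lemma coeff_topSeries_of_le {w a : ℕ} (h : a ≤ w) : coeff a (topSeries w) = 0 := by
  rw [topSeries, coeff_mk, topCount_eq_zero h, Nat.cast_zero]

/-- The bivariate generating function `∑ w, u ^ w * topSeries w` at `u = X ^ m`. -/
noncomputable def widthSeries (m : ℕ) : PowerSeries ℚ :=
  PowerSeries.mk fun n => ∑ w ∈ Finset.range (n + 1), coeff n (X ^ (m * w) * topSeries w)

lemma coeff_X_pow_mul_topSeries_of_le {m w n : ℕ} (h : n ≤ w) :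
    coeff n (X ^ (m * w) * topSeries w) = 0 := by
  rw [coeff_X_pow_mul']
  split_ifs
  · exact coeff_topSeries_of_le (by omega)
  · rfl

/-- Since `X ^ (w + 1)` divides `topSeries w`, identities for `widthSeries` can be proved for
partial sums modulo every `X ^ N`. -/
lemma X_pow_dvd_widthSeries_sub (m N : ℕ) :
    X ^ N ∣ widthSeries m - ∑ w ∈ Finset.range N, X ^ (m * w) * topSeries w := by
  rw [X_pow_dvd_iff]
  intro n hn
  rw [map_sub, widthSeries, coeff_mk, map_sum, sub_eq_zero]
  refine Finset.sum_subset (fun w hw => ?_) fun w _ hw => ?_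
  · rw [Finset.mem_range] at hw ⊢
    omega
  · rw [Finset.mem_range] at hw
    exact coeff_X_pow_mul_topSeries_of_le (by omega)

lemma eq_of_forall_X_pow_dvd_sub {f g : PowerSeries ℚ} (h : ∀ N : ℕ, X ^ N ∣ f - g) : f = g := by
  ext n
  have := X_pow_dvd_iff.1 (h (n + 1)) n (by omega)
  rwa [map_sub, sub_eq_zero] at this

/-- This is `topSeries_eq` multiplied by `u ^ w` and summed, at `u = X ^ m`; the factor `X ^ w`
there turns `u` into `X * u`. -/
lemma sum_topSeries (m N : ℕ) :
    (1 - 2 * X) * ∑ w ∈ Finset.range N, X ^ (m * w) * topSeries w +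
      X ^ 2 * ∑ w ∈ Finset.range N, X ^ ((m + 1) * w) * topSeries w =
    (1 - X) * X * ∑ w ∈ Finset.range N, X ^ ((m + 1) * w) * excSeries w := by
  simp only [Finset.mul_sum, ← Finset.sum_add_distrib]
  refine Finset.sum_congr rfl fun w _ => ?_
  linear_combination X ^ (m * w) * topSeries_eq w

/-- The recursion `excSeries_succ` summed against `X ^ (k * w)`. The boundary term is divisible by
`X ^ N` once `k ≥ 1`. -/
lemma sum_excSeries (k N : ℕ) :
    (1 - X - X ^ k) * ∑ w ∈ Finset.range N, X ^ (k * w) * excSeries w =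
    (1 - X) * (1 + X ^ k * ∑ w ∈ Finset.range N, X ^ (k * w) * topSeries w) -
      (1 - X) * X ^ (k * N) * excSeries N := by
  induction N with
  | zero => simp [excSeries_zero]
  | succ N ih =>
    rw [Finset.sum_range_succ, Finset.sum_range_succ]
    linear_combination ih + X ^ (k * (N + 1)) * excSeries_succ N

/-- The functional equation satisfied by the bivariate generating function. -/
lemma widthSeries_eq (m : ℕ) :
    (1 - 2 * X) * (1 - X - X ^ (m + 1)) * widthSeries m = X * (1 - X) ^ 2 -
      X ^ 2 * (1 - X - X ^ m + X ^ (m + 1) - X ^ (m + 2)) * widthSeries (m + 1) := by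
  refine eq_of_forall_X_pow_dvd_sub fun N => ?_
  obtain ⟨a, ha⟩ := X_pow_dvd_widthSeries_sub m N
  obtain ⟨b, hb⟩ := X_pow_dvd_widthSeries_sub (m + 1) N
  have h1 := sum_topSeries m N
  -- With `k = m + 1` this is the sum of `excSeries` occurring in `h1`, which can now be eliminated.
  have h2 := sum_excSeries (m + 1) N
  refine ⟨(1 - 2 * X) * (1 - X - X ^ (m + 1)) * a +
    X ^ 2 * (1 - X - X ^ m + X ^ (m + 1) - X ^ (m + 2)) * b -
      (1 - X) ^ 2 * X * X ^ (m * N) * excSeries N, ?_⟩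
  linear_combination (1 - 2 * X) * (1 - X - X ^ (m + 1)) * ha +
    X ^ 2 * (1 - X - X ^ m + X ^ (m + 1) - X ^ (m + 2)) * hb +
    (1 - X - X ^ (m + 1)) * h1 + (1 - X) * X * h2

/-! ### Iteration of the functional equation -/

lemma inv_mul_self_of_constantCoeff {f : PowerSeries ℚ} (h : constantCoeff f = 1) :
    f⁻¹ * f = 1 := PowerSeries.inv_mul_cancel f (by rw [h]; exact one_ne_zero)

lemma inv_pow_eq (f : PowerSeries ℚ) (m : ℕ) : (f ^ m)⁻¹ = f⁻¹ ^ m := by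
  induction m with
  | zero => simp
  | succ m ih => rw [pow_succ, PowerSeries.mul_inv_rev, ih, pow_succ']

lemma one_sub_two_mul_X_inv_mul : (1 - 2 * X : PowerSeries ℚ)⁻¹ * (1 - 2 * X) = 1 :=
  inv_mul_self_of_constantCoeff (by simp)

lemma one_sub_X_inv_mul : (1 - X : PowerSeries ℚ)⁻¹ * (1 - X) = 1 :=
  inv_mul_self_of_constantCoeff (by simp)

lemma denominator_inv_mul (m : ℕ) :
    (1 - X - X ^ (m + 1) : PowerSeries ℚ)⁻¹ * (1 - X - X ^ (m + 1)) = 1 :=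
  inv_mul_self_of_constantCoeff (by simp)

/-- The factor of the functional equation. -/
noncomputable def factor (m : ℕ) : PowerSeries ℚ :=
  -X ^ 2 * (1 - 2 * X)⁻¹ *
    ((1 - X - X ^ m + X ^ (m + 1) - X ^ (m + 2)) * (1 - X - X ^ (m + 1))⁻¹)

lemma widthSeries_step (m : ℕ) : widthSeries m =
    X * (1 - X) ^ 2 * (1 - 2 * X)⁻¹ * (1 - X - X ^ (m + 1))⁻¹ +
      factor m * widthSeries (m + 1) := by
  have h := widthSeries_eq m
  have h1 := one_sub_two_mul_X_inv_mul
  have h2 := denominator_inv_mul m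
  rw [factor]
  set a := (1 - 2 * X : PowerSeries ℚ)⁻¹
  set b := (1 - X - X ^ (m + 1) : PowerSeries ℚ)⁻¹
  linear_combination a * b * h - widthSeries m * (h1 + a * (1 - 2 * X) * h2)

/-- At `m = 0` the numerator collapses to `-X ^ 2`. This is why the product in `summand` starts at
`k = 1` and `(1 - 2 * X) ^ 2` stands in front of the sum. -/
lemma factor_zero : factor 0 = X ^ 4 * (1 - 2 * X)⁻¹ ^ 2 := by
  have : (1 - X - X ^ (0 + 1) : PowerSeries ℚ) = 1 - 2 * X := by ring
  rw [factor, this]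
  ring

lemma prod_factor_succ (m : ℕ) : ∏ k ∈ Finset.range (m + 1), factor k =
    X ^ 4 * (1 - 2 * X)⁻¹ ^ 2 * ((-1) ^ m * X ^ (2 * m) * (1 - 2 * X)⁻¹ ^ m *
      ∏ k ∈ Finset.Ico 1 (m + 1),
        (1 - X - X ^ k + X ^ (k + 1) - X ^ (k + 2)) * (1 - X - X ^ (k + 1))⁻¹) := by
  rw [Finset.range_eq_Ico, Finset.prod_eq_prod_Ico_succ_bot (Nat.succ_pos m), factor_zero]
  congr 1
  simp only [factor]
  rw [Finset.prod_mul_distrib, Finset.prod_const, Nat.card_Ico, Nat.zero_add,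
    Nat.succ_sub_one, mul_pow, neg_pow, ← pow_mul]

lemma summand_succ (m : ℕ) : summand (m + 1) =
    X ^ (2 * (m + 1)) * ((-1) ^ (m + 1) * (1 - 2 * X)⁻¹ ^ (m + 1) * (1 - X - X ^ (m + 2))⁻¹ *
    ∏ k ∈ Finset.Ico 1 (m + 1),
      (1 - X - X ^ k + X ^ (k + 1) - X ^ (k + 2)) * (1 - X - X ^ (k + 1))⁻¹) := by
  rw [summand, PowerSeries.mul_inv_rev, inv_pow_eq]
  ring

/-- The step at `m = 0` yields the isolated first term, as there `1 - X - X ^ (m + 1)` is again `1 -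
2 * X`; each further step yields one `summand`. -/
lemma iterate_widthSeries (M : ℕ) : widthSeries 0 =
    X * (1 - X) ^ 2 * (1 - 2 * X)⁻¹ ^ 2 -
      X ^ 3 * (1 - X) ^ 2 * (1 - 2 * X)⁻¹ ^ 2 * ∑ m ∈ Finset.range M, summand (m + 1) +
      (∏ k ∈ Finset.range (M + 1), factor k) * widthSeries (M + 1) := by
  induction M with
  | zero =>
    have h := widthSeries_step 0
    have h1 : (1 - X - X ^ (0 + 1) : PowerSeries ℚ) = 1 - 2 * X := by ring
    rw [h1] at h
    simp only [zero_add, Finset.range_zero, Finset.sum_empty, Finset.prod_range_one]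
    linear_combination h
  | succ M ih =>
    rw [ih, Finset.prod_range_succ _ (M + 1), Finset.sum_range_succ]
    have h := widthSeries_step (M + 1)
    rw [summand_succ]
    have h1 := prod_factor_succ M
    linear_combination (∏ k ∈ Finset.range (M + 1), factor k) * h +
      X * (1 - X) ^ 2 * (1 - 2 * X)⁻¹ * (1 - X - X ^ (M + 2))⁻¹ * h1

/-! ### Formal convergence -/

lemma coeff_summand_succ {d m : ℕ} (h : d ≤ m) : coeff d (summand (m + 1)) = 0 := by
  rw [summand_succ, coeff_X_pow_mul', if_neg (by omega)]

lemma finite_coeff_summand (d : ℕ) : {m : ℕ | coeff d (summand (m + 1)) ≠ 0}.Finite := by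
  refine (Finset.range d).finite_toSet.subset fun m hm => ?_
  rw [Finset.mem_coe, Finset.mem_range]
  by_contra h
  exact hm (coeff_summand_succ (by omega))

open scoped PowerSeries.WithPiTopology in
lemma hasSum_summand : HasSum (fun m : ℕ => summand (m + 1))
    (PowerSeries.mk fun d => ∑ m ∈ Finset.range d, coeff d (summand (m + 1))) := by
  rw [PowerSeries.WithPiTopology.hasSum_iff_hasSum_coeff]
  intro d
  rw [coeff_mk]
  refine hasSum_sum_of_ne_finset_zero fun m hm => ?_
  rw [Finset.mem_range] at hm
  exact coeff_summand_succ (by omega)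

open scoped PowerSeries.WithPiTopology in
lemma X_pow_dvd_tsum_sub (M : ℕ) :
    X ^ M ∣ (∑' m : ℕ, summand (m + 1)) - ∑ m ∈ Finset.range M, summand (m + 1) := by
  rw [hasSum_summand.tsum_eq, X_pow_dvd_iff]
  intro d hd
  rw [map_sub, coeff_mk, map_sum, sub_eq_zero]
  refine Finset.sum_subset (fun m hm => ?_) fun m _ hm => ?_
  · rw [Finset.mem_range] at hm ⊢
    omega
  · rw [Finset.mem_range] at hm
    exact coeff_summand_succ (by omega)

open scoped PowerSeries.WithPiTopology in
lemma widthSeries_zero_eq : widthSeries 0 =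
    X * (1 - X) ^ 2 * (1 - 2 * X)⁻¹ ^ 2 -
      X ^ 3 * (1 - X) ^ 2 * (1 - 2 * X)⁻¹ ^ 2 * ∑' m : ℕ, summand (m + 1) := by
  refine eq_of_forall_X_pow_dvd_sub fun M => ?_
  obtain ⟨a, ha⟩ := X_pow_dvd_tsum_sub M
  have h := iterate_widthSeries M
  rw [prod_factor_succ] at h
  set P := ∏ k ∈ Finset.Ico 1 (M + 1),
    ((1 - X - X ^ k + X ^ (k + 1) - X ^ (k + 2)) * (1 - X - X ^ (k + 1))⁻¹ : PowerSeries ℚ)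
  -- The remainder contains `X ^ (2 * M)`; one factor `X ^ M` is split off as the divisor.
  refine ⟨X ^ 3 * (1 - X) ^ 2 * (1 - 2 * X)⁻¹ ^ 2 * a +
    X ^ 4 * (1 - 2 * X)⁻¹ ^ 2 * ((-1) ^ M * X ^ M * (1 - 2 * X)⁻¹ ^ M * P) *
      widthSeries (M + 1), ?_⟩
  linear_combination h + X ^ 3 * (1 - X) ^ 2 * (1 - 2 * X)⁻¹ ^ 2 * ha

/-! ### The generating function of 3-sided prudent polygons -/

lemma mk_one_eq : (PowerSeries.mk 1 : PowerSeries ℚ) = (1 - X)⁻¹ :=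
  (eq_inv_iff_mul_eq_one (by simp)).2 (PowerSeries.mk_one_mul_one_sub_eq_one ℚ)

lemma mk_two_pow_eq : (PowerSeries.mk fun n => (2 : ℚ) ^ n) = (1 - 2 * X)⁻¹ := by
  refine (eq_inv_iff_mul_eq_one (by simp)).2 ?_
  ext n
  rw [mul_sub, mul_one, ← mul_assoc, map_sub, coeff_mk, ← map_ofNat (C (R := ℚ)) 2]
  cases n with
  | zero => simp
  | succ n =>
    rw [coeff_succ_mul_X, coeff_mul_C, coeff_mk, coeff_one, if_neg (by omega), pow_succ, sub_self]

/-- The factor `2` accounts for reflection, and the three terms for `closing`, `columnPolygon` and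
`hanging`. -/
lemma PA3_eq : PA3 = 2 * (widthSeries 0 + X * ((1 - X)⁻¹ + (1 - 2 * X)⁻¹)) := by
  rw [← mk_one_eq, ← mk_two_pow_eq, ← map_ofNat (C (R := ℚ)) 2]
  ext n
  rw [PA3, coeff_mk, coeff_C_mul, map_add, widthSeries, coeff_mk]
  cases n with
  | zero => simp [threeSidedPolygons_zero, coeff_topSeries_of_le]
  | succ n =>
    -- `widthSeries` also sums over `w = n + 1`, where the coefficient vanishes.
    rw [ncard_threeSidedPolygons_succ, Finset.sum_range_succ _ (n + 1),
      coeff_X_pow_mul_topSeries_of_le le_rfl, coeff_succ_X_mul]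
    simp [topSeries]

end Prudent

open Prudent PowerSeries in
open scoped PowerSeries.WithPiTopology in
/-- The sets of polygons that are counted are finite, the series over `m ≥ 1` converges formally
(each power of `q` occurs in finitely many summands only), the area generating function is given
by the formula, and its expansion begins as listed. -/
theorem theorem2p3 :
    (∀ n, (threeSidedPolygons n).Finite) ∧
    (∀ d : ℕ, {m : ℕ | coeff d (summand (m + 1)) ≠ 0}.Finite) ∧
    Summable (fun m : ℕ => summand (m + 1)) ∧
    PA3 = -2 * X ^ 3 * (1 - X) ^ 2 * ((1 - 2 * X) ^ 2)⁻¹ * (∑' m : ℕ, summand (m + 1)) +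
      2 * X * (3 - 10 * X + 9 * X ^ 2 - X ^ 3) * ((1 - 2 * X) ^ 2 * (1 - X))⁻¹ ∧
    (∀ n < 11, coeff n PA3 =
      ([0, 6, 10, 20, 42, 92, 204, 454, 1010, 2242, 4962] : List ℚ).getD n 0) := by
  refine ⟨finite_threeSidedPolygons, finite_coeff_summand, hasSum_summand.summable, ?_, ?_⟩
  · rw [PA3_eq, widthSeries_zero_eq, PowerSeries.mul_inv_rev, inv_pow_eq]
    have h1 := one_sub_two_mul_X_inv_mul
    have h2 := one_sub_X_inv_mul
    set a := (1 - 2 * X : PowerSeries ℚ)⁻¹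
    set b := (1 - X : PowerSeries ℚ)⁻¹
    -- Over the common denominator the rational terms add up by `(1-q)^3 + (1-2q)^2 + (1-q)(1-2q) =
    -- 3 - 10q + 9q^2 - q^3`.
    linear_combination (-2 * X * b * (a * (1 - 2 * X) + 1) - 2 * X * a) * h1 +
      (-2 * X * (1 - X) ^ 2 * a ^ 2 - 2 * X * a ^ 2 * (1 - 2 * X)) * h2
  · intro n hn
    rw [PA3, coeff_mk, ncard_threeSidedPolygons_values n hn]
    interval_cases n <;> simp
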